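/- **Model.** There are $n$ independent voters. Each supports the first of two candidates (opinion vector $(1,0)$, otherwise $(0,1)$) with probability $p_0\in[0,1]$ and, independently, is acted on with probability $\pi_0\in[0,1]$ by an intervention vector $v=(a,b)$, $a,b>0$. It replaces the opinion $x$ by $(1,0)$ if the first coordinate of $x+\langle x,v\rangle v$ exceeds the second, and by $(0,1)$ otherwise. Assume $a^2+1<ab$ and $b^2+1\ge ab$ (only supporters of the first candidate are turned). Then a voter supports the first candidate after the intervention with probability $p'=p_0(1-\pi_0)$; let $\hat p'$ be the observed proportion of votes for the first candidate after the intervention. For $0\le p'\le p_0\le 1$ let $\eta(p_0,p',n)=f(\mu_2,\Sigma_2,n)$ be the probability that the two components of a $\mathcal N_2(\mu_2,\Sigma_2/n)$ vector have the same sign, where $$\mu_2=\begin{pmatrix}2p_0-1\\2p'-1\end{pmatrix},\qquad \Sigma_2=\begin{pmatrix}4p_0-4p_0^2&4p'-4p_0p'\\4p'-4p_0p'&4p'-4p'^2\end{pmatrix}.$$ **Cost function.** Let $h$ be a probability density supported on $[0,1]$ and continuous there, with distribution function $H$, and put $$\phi(p')=\frac{p'}{H(1-p')}\int_0^{1-p'}\frac{h(\pi)}{1-\pi}\,d\pi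 .$$ Let $\Theta$ be the set of parameters $(p_0,\pi_0)\in[0,1]^2$ with $p'>0$ and $H(1-p')>0$ that satisfy the assumption $$\int_0^{1-p'}\frac{\pi_0-\pi}{1-\pi}\,h(\pi)\,d\pi=0 .$$ **Interval.** Let $\alpha,\beta\in(0,1)$ with $(1-\beta)^2=1-\alpha$, let $z_{\beta/2}$ be the upper $\beta/2$ quantile of the standard normal law, $\gamma_n(p)=\sqrt{p(1-p)}\,z_{\beta/2}/\sqrt n$, $S_1(\hat p')=(\hat p'-\gamma_n(\hat p'),\hat p'+\gamma_n(\hat p'))$, and $S_2(\hat p')=(\phi(\hat p')-|\phi'(\hat p')|\gamma_n(\hat p'),\ \phi(\hat p')+|\phi'(\hat p')|\gamma_n(\hat p'))$. Let $m$ and $M$ be the infimum and the supremum of $\eta(q_0,q',n)$ over all $q'\in S_1(\hat p')$, $q_0\in S_2(\hat p')$ with $0\le q'\le q_0\le1$ (the value being $0$ if there are none). Let $\tau_c\in(0,1)$. **Theorem.** (1) $(m,M)$ is an asymptotic $100(1-\alpha)\%$ confidence interval for $f(\mu_2,\Sigma_2,n)$, and the test that rejects the hypothesis $H_0^n:\ \eta(p_0,p',n)\ge\tau_c$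 of no significant intervention when $M<\tau_c$ has asymptotic level $\alpha$. More precisely, for every compact set $K\subset\Theta$ of parameters with $\phi'(p')\neq0$ there is an $N$ such that for all $n\ge N$ and all $(p_0,\pi_0)\in K$, $$\mathbb P_{p_0,\pi_0}\bigl(m<f(\mu_2,\Sigma_2,n)<M\bigr)\ge 1-\alpha,$$ and, if $\eta(p_0,p',n)\ge\tau_c$, then $\mathbb P_{p_0,\pi_0}(M<\tau_c)\le\alpha$. (2) The test is consistent: for every $(p_0,\pi_0)\in\Theta$ with $(2p_0-1)(2p'-1)<0$, as $n\to\infty$, $\eta(p_0,p',n)\to0$ (so that $H_0^n$ is false for all large $n$) and $\mathbb P_{p_0,\pi_0}(M<\tau_c)\to1$. -/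

import Mathlib

open MeasureTheory ProbabilityTheory Filter Topology unitInterval

namespace VoterModel

noncomputable section

/-! ### Voters and interventions -/

/-- The opinion vector of a voter: `(1, 0)` for the first candidate, `(0, 1)` for the second. -/
def opinionVec (first : Bool) : ℝ × ℝ := if first then (1, 0) else (0, 1)

/-- The vector `x + ⟨x, v⟩ v` obtained when the intervention `v = (a, b)` acts on `x`. -/
def intervene (a b : ℝ) (x : ℝ × ℝ) : ℝ × ℝ := x + (x.1 * a + x.2 * b) • (a, b)

/-- The opinion read off a vector: `(1, 0)` if the first coordinate is greater than the second
one, and `(0, 1)` otherwise. -/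
def readOpinion (y : ℝ × ℝ) : ℝ × ℝ := if y.2 < y.1 then (1, 0) else (0, 1)

/-- The opinion vector after the intervention of a voter `w`, where `w.1` says whether the voter
originally supports the first candidate, and `w.2` whether the intervention acts on the voter. -/
def postOpinion (a b : ℝ) (w : Bool × Bool) : ℝ × ℝ :=
  if w.2 then readOpinion (intervene a b (opinionVec w.1)) else opinionVec w.1

/-- The law of one voter: the voter supports the first candidate with probability `p₀ = θ.1`
and is, independently, acted on by the intervention with probability `π₀ = θ.2`. -/
def voterLaw (θ : I × I) : Measure (Bool × Bool) :=
  (bernoulliMeasure true false θ.1).prod (bernoulliMeasure true false θ.2)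

/-- The joint law of `n` independent voters. -/
def electionLaw (θ : I × I) (n : ℕ) : Measure (Fin n → Bool × Bool) :=
  Measure.pi fun _ => voterLaw θ

/-- The observed proportion `p̂'` of votes for the first candidate after the intervention. -/
def observedProp (a b : ℝ) (n : ℕ) (ω : Fin n → Bool × Bool) : ℝ :=
  (∑ i, (postOpinion a b (ω i)).1) / n

/-- The probability `p'` of supporting the first candidate after an intervention which turns only
supporters of the first candidate: `p' = p₀ (1 - π₀)`. -/
def pPost (θ : I × I) : ℝ := (θ.1 : ℝ) * (1 - (θ.2 : ℝ))

/-! ### The probability of an unchanged majority -/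

/-- `f(μ, Σ, n)`: the probability that the two components of a `N₂(μ, Σ / n)` vector have the same
sign. -/
def f (μ : EuclideanSpace ℝ (Fin 2)) (S : Matrix (Fin 2) (Fin 2) ℝ) (n : ℕ) : ℝ :=
  (multivariateGaussian μ ((n : ℝ)⁻¹ • S)).real
    {x | SignType.sign (x 0) = SignType.sign (x 1)}

def mu2 (p₀ p' : ℝ) : EuclideanSpace ℝ (Fin 2) := !₂[2 * p₀ - 1, 2 * p' - 1]

def Sigma2 (p₀ p' : ℝ) : Matrix (Fin 2) (Fin 2) ℝ :=
  !![4 * p₀ - 4 * p₀ ^ 2, 4 * p' - 4 * p₀ * p';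
     4 * p' - 4 * p₀ * p', 4 * p' - 4 * p' ^ 2]

/-- `η(p₀, p', n) = f(μ₂, Σ₂, n)`. -/
def eta (p₀ p' : ℝ) (n : ℕ) : ℝ := f (mu2 p₀ p') (Sigma2 p₀ p') n

/-! ### The cost function -/

/-- `h` is a probability density supported on `[0, 1]` and continuous there. -/
structure IsCostDensity (h : ℝ → ℝ) : Prop where
  nonneg : ∀ t, 0 ≤ h t
  continuousOn : ContinuousOn h (Set.Icc 0 1)
  eq_zero : ∀ t, t ∉ Set.Icc (0 : ℝ) 1 → h t = 0
  integral_eq_one : ∫ t, h t = 1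

/-- The distribution function `H` of the density `h`. -/
def H (h : ℝ → ℝ) (x : ℝ) : ℝ := ∫ t in Set.Iic x, h t

/-- `φ(p') = p' / H(1 - p') * ∫_0^{1-p'} h(π) / (1 - π) dπ`. -/
def phi (h : ℝ → ℝ) (p' : ℝ) : ℝ :=
  p' / H h (1 - p') * ∫ t in (0 : ℝ)..(1 - p'), 1 / (1 - t) * h t

/-- The assumption `∫_0^{1-p'} (π₀ - π) / (1 - π) h(π) dπ = 0` on the cost function. -/
def CostAssumption (h : ℝ → ℝ) (θ : I × I) : Prop :=
  ∫ t in (0 : ℝ)..(1 - pPost θ), ((θ.2 : ℝ) - t) / (1 - t) * h t = 0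

/-- The parameters `(p₀, π₀)` that satisfy the assumption on the cost function, with `p' > 0` and
`H(1 - p') > 0`. -/
def Params (h : ℝ → ℝ) : Set (I × I) :=
  {θ | 0 < pPost θ ∧ 0 < H h (1 - pPost θ) ∧ CostAssumption h θ}

/-! ### The confidence interval -/

/-- `γ_n(p) = √(p (1 - p)) z / √n`. -/
def gam (z : ℝ) (n : ℕ) (p : ℝ) : ℝ := √(p * (1 - p)) * z / √(n : ℝ)

def S1 (z : ℝ) (n : ℕ) (p : ℝ) : Set ℝ := Set.Ioo (p - gam z n p) (p + gam z n p)

def S2 (h : ℝ → ℝ) (z : ℝ) (n : ℕ) (p : ℝ) : Set ℝ :=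
  Set.Ioo (phi h p - |deriv (phi h) p| * gam z n p) (phi h p + |deriv (phi h) p| * gam z n p)

/-- The values `η(p₀, p', n)` for `p' ∈ S₁`, `p₀ ∈ S₂`. The pair `(p₀, p')` ranges over the domain
`0 ≤ p' ≤ p₀ ≤ 1` of `η`, which is exactly where `Σ₂` is a dispersion matrix. -/
def etaValues (h : ℝ → ℝ) (z : ℝ) (n : ℕ) (p : ℝ) : Set ℝ :=
  {y | ∃ p₀ p' : ℝ, p' ∈ S1 z n p ∧ p₀ ∈ S2 h z n p ∧ 0 ≤ p' ∧ p' ≤ p₀ ∧ p₀ ≤ 1 ∧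
    y = eta p₀ p' n}

/-- The lower end `m` of the interval (the values of `η` lie in `[0, 1]`). -/
def lowerEnd (h : ℝ → ℝ) (z : ℝ) (n : ℕ) (p : ℝ) : ℝ := sInf (etaValues h z n p)

/-- The upper end `M` of the interval (the values of `η` lie in `[0, 1]`). -/
def upperEnd (h : ℝ → ℝ) (z : ℝ) (n : ℕ) (p : ℝ) : ℝ := sSup (etaValues h z n p)

end

end VoterModel

namespace VoterModel

/-! ### The observed proportion -/

/-! The cost assumption is linear in `π₀` and says exactly `p₀ = φ(p')`
(`IsCostDensity.params_spec`). The only randomness is therefore that of `p̂'`, and both memberships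
`p' ∈ S₁` and `p₀ ∈ S₂` follow from one bound on `|p̂' - p'|`: near `p'` the map `φ` is almost
affine with nonzero slope, so a deviation below `r` times the half-width, with `r < 1`, gives both
(`IsCostDensity.eventually_mem_S1_S2`). By the central limit theorem this event has limiting
probability as close to `1 - β` as desired, and `1 - β > (1 - β)² = 1 - α` leaves room for the loss
caused by `r`. Uniformity on `K` comes from a Lebesgue number for the analytic part and from running
the limit theorem along a sequence of worst parameters (`eventually_forall_lt_electionLaw`).

The strict inequalities `m < η < M` need strict monotonicity of `η` in `p'`
(`eta_strictMono_right`). In the time scale of the odds `s = p / (1 - p)`, the two components are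
positive multiples of `X_s = c (s - 1) + B_s`, with `B` a Brownian motion and `c = √n / 2`, at the
odds of `p₀` and of `p'`. For times `s < u < t` it must be shown that `X_u` agrees in sign with
`X_t` more often than `X_s` does. The two events can differ only when the sign changes between `s`
and `u`; pairing each such path with its reflection, upward crossings are at least as likely as
downward ones, and the upward drift makes a positive sign at `t` the likelier continuation
(`integral_sgn_sub_mul_pos`).

For consistency, `p' < 1/2 < p₀`. Chebyshev's inequality gives `η = O(1/n)` uniformly near such a
pair, and the two intervals shrink, so `M` is small whenever `p̂'` is close to `p'`. -/

/-- The indicator of a vote for the first candidate after the intervention. -/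
noncomputable def postVote (a b : ℝ) (w : Bool × Bool) : ℝ := (postOpinion a b w).1

/-- The intervention sends `(1, 0)` to `(1 + a², ab)` and `(0, 1)` to `(ab, 1 + b²)`, so the two
hypotheses decide which coordinate wins. A tie is read as `(0, 1)`, which is why the second one need
not be strict. -/
lemma postVote_eq {a b : ℝ} (hab₁ : a ^ 2 + 1 < a * b) (hab₂ : a * b ≤ b ^ 2 + 1)
    (w : Bool × Bool) : postVote a b w = if w.1 = true ∧ w.2 = false then 1 else 0 := by
  rcases w with ⟨_ | _, _ | _⟩
  · simp [postVote, postOpinion, opinionVec]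
  · have : ¬ (1 + b * b < b * a) := by nlinarith
    simp [postVote, postOpinion, opinionVec, readOpinion, intervene, this]
  · simp [postVote, postOpinion, opinionVec]
  · have : ¬ (a * b < 1 + a * a) := by nlinarith
    simp [postVote, postOpinion, opinionVec, readOpinion, intervene, this]

instance (θ : I × I) : IsProbabilityMeasure (voterLaw θ) := by
  unfold voterLaw; infer_instance

instance (θ : I × I) (n : ℕ) : IsProbabilityMeasure (electionLaw θ n) := by
  unfold electionLaw; infer_instance

/-- The values are in a general space because the formula serves both the real mean and the complex
characteristic function. -/
lemma integral_comp_postVote {E : Type*} [NormedAddCommGroup E] [NormedSpace ℝ E] [CompleteSpace E]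
    {a b : ℝ} (hab₁ : a ^ 2 + 1 < a * b) (hab₂ : a * b ≤ b ^ 2 + 1) (θ : I × I) (g : ℝ → E) :
    ∫ w, g (postVote a b w) ∂voterLaw θ = pPost θ • g 1 + (1 - pPost θ) • g 0 := by
  rw [voterLaw, integral_prod _ (Integrable.of_finite)]
  simp only [integral_bernoulliMeasure, postVote_eq hab₁ hab₂, pPost]
  simp only [true_and, Bool.true_eq_false, if_false, if_true, Bool.false_eq_true, false_and]
  module

lemma pPost_le (θ : I × I) : pPost θ ≤ θ.1 := by
  have h1 := θ.1.2.1; have h2 := θ.2.2.1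
  unfold pPost; nlinarith

lemma continuous_pPost : Continuous pPost := by unfold pPost; fun_prop

/-- The standard deviation of a vote cast for the first candidate with probability `p`. -/
noncomputable def voteSd (p : ℝ) : ℝ := √(p * (1 - p))

lemma observedProp_eq (a b : ℝ) (n : ℕ) (ω : Fin n → Bool × Bool) :
    observedProp a b n ω = (∑ i, postVote a b (ω i)) / n := rfl

/-- Chebyshev's inequality for the observed proportion. -/
lemma observedProp_chebyshev {a b : ℝ} (hab₁ : a ^ 2 + 1 < a * b) (hab₂ : a * b ≤ b ^ 2 + 1)
    (θ : I × I) {n : ℕ} (hn : 1 ≤ n) {δ : ℝ} (hδ : 0 < δ) :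
    (electionLaw θ n).real {ω | δ ≤ |observedProp a b n ω - pPost θ|} ≤ 1 / (n * δ ^ 2) := by
  have hn' : (0 : ℝ) < n := by exact_mod_cast hn
  have hmean : ∫ ω, observedProp a b n ω ∂electionLaw θ n = pPost θ := by
    simp only [observedProp_eq, integral_div]
    rw [integral_finsetSum _ (fun _ _ ↦ Integrable.of_finite)]
    have : ∀ i : Fin n, ∫ ω, postVote a b (ω i) ∂electionLaw θ n = pPost θ := by
      intro i
      rw [electionLaw, integral_comp_eval (μ := fun _ : Fin n ↦ voterLaw θ)
        (f := postVote a b) (by fun_prop)]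
      simpa using integral_comp_postVote hab₁ hab₂ θ (fun x : ℝ ↦ x)
    simp [this]
    field_simp
  have hvar : Var[observedProp a b n; electionLaw θ n] ≤ 1 / n := by
    have h1 : observedProp a b n = fun ω ↦ (n : ℝ)⁻¹ * (∑ i, fun ω : Fin n → Bool × Bool ↦
        postVote a b (ω i)) ω := by
      ext ω; simp [observedProp_eq, div_eq_inv_mul]
    rw [h1, variance_const_mul, electionLaw, variance_sum_pi (fun _ ↦ MemLp.of_discrete)]
    have h2 : Var[postVote a b; voterLaw θ] ≤ ((1 - 0) / 2) ^ 2 := by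
      refine variance_le_sq_of_bounded (.of_forall fun w ↦ ?_) (by fun_prop)
      rw [postVote_eq hab₁ hab₂]; split_ifs <;> simp
    simp only [Finset.sum_const, Finset.card_univ, Fintype.card_fin, nsmul_eq_mul]
    calc ((n : ℝ)⁻¹) ^ 2 * ((n : ℝ) * Var[postVote a b; voterLaw θ])
        ≤ ((n : ℝ)⁻¹) ^ 2 * ((n : ℝ) * 1) := by gcongr; linarith
      _ = 1 / (n : ℝ) := by field_simp
  have h := meas_ge_le_variance_div_sq (μ := electionLaw θ n) (X := observedProp a b n)
    MemLp.of_discrete hδ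
  rw [hmean] at h
  refine (ENNReal.toReal_le_of_le_ofReal (div_nonneg (variance_nonneg _ _) (sq_nonneg δ))
    h).trans ?_
  rw [div_le_div_iff₀ (by positivity) (by positivity)]
  rw [le_div_iff₀ hn'] at hvar
  nlinarith [sq_nonneg δ]

/-- The standardized observed proportion. -/
noncomputable def stdProp (a b : ℝ) (θ : I × I) (n : ℕ) (ω : Fin n → Bool × Bool) : ℝ :=
  √n * (observedProp a b n ω - pPost θ) / voteSd (pPost θ)

lemma stdProp_eq (a b : ℝ) (θ : I × I) {n : ℕ} (hn : 1 ≤ n) (ω : Fin n → Bool × Bool) :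
    stdProp a b θ n ω = ∑ i, (postVote a b (ω i) - pPost θ) / voteSd (pPost θ) / √n := by
  have hn' : (0 : ℝ) < n := by exact_mod_cast hn
  have hs : √(n : ℝ) ≠ 0 := (Real.sqrt_pos.2 hn').ne'
  rw [stdProp, observedProp_eq, ← Finset.sum_div, ← Finset.sum_div, Finset.sum_sub_distrib]
  simp only [Finset.sum_const, Finset.card_univ, Fintype.card_fin, nsmul_eq_mul]
  rw [div_right_comm]
  congr 1
  rw [eq_div_iff hs]
  have := Real.mul_self_sqrt hn'.le
  field_simp
  rw [sq, this]

/-! ### Central limit theorem by characteristic functions -/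

lemma norm_cexp_sub_taylor_le {x : ℝ} (hx : |x| ≤ 1) :
    ‖Complex.exp (x * Complex.I) - (1 + x * Complex.I - (x : ℂ) ^ 2 / 2)‖ ≤ |x| ^ 3 := by
  have h := Complex.exp_bound (x := x * Complex.I) (by simpa using hx) (n := 3) (by norm_num)
  have he : ∑ m ∈ Finset.range 3, (x * Complex.I : ℂ) ^ m / (m.factorial : ℂ)
      = 1 + x * Complex.I - (x : ℂ) ^ 2 / 2 := by
    simp [Finset.sum_range_succ, Nat.factorial, mul_pow]
    ring
  rw [he] at h
  refine h.trans ?_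
  have : ‖(x * Complex.I : ℂ)‖ = |x| := by simp
  rw [this]
  have : 0 ≤ |x| ^ 3 := by positivity
  norm_num [Nat.factorial]
  linarith

/-- The characteristic function of a standardized Bernoulli variable, to second order. -/
lemma norm_bernoulli_charFun_sub_le {p s : ℝ} (hp₀ : 0 < p) (hp₁ : p < 1)
    (hs : |s| ≤ voteSd p) :
    ‖(p : ℂ) * Complex.exp (((s * ((1 - p) / voteSd p) : ℝ) : ℂ) * Complex.I)
      + (1 - p) * Complex.exp (((s * ((0 - p) / voteSd p) : ℝ) : ℂ) * Complex.I)
      - (1 - (s : ℂ) ^ 2 / 2)‖ ≤ (|s| / voteSd p) ^ 3 := by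
  set r₀ := voteSd p with hr₀
  have hpq : 0 < p * (1 - p) := mul_pos hp₀ (by linarith)
  have hr₀0 : 0 < r₀ := Real.sqrt_pos.2 hpq
  have hr₀2 : r₀ ^ 2 = p * (1 - p) := Real.sq_sqrt hpq.le
  have hr : |s| / r₀ ≤ 1 := (div_le_one hr₀0).2 hs
  -- Both values of the standardized variable have modulus at most `1 / r₀`, so both exponents lie
  -- in the range of the Taylor estimate.
  have hx : |s * ((1 - p) / r₀)| ≤ |s| / r₀ := by
    rw [abs_mul, abs_div, abs_of_pos hr₀0, abs_of_pos (by linarith : 0 < 1 - p), mul_div_assoc']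
    gcongr; nlinarith [abs_nonneg s]
  have hy : |s * ((0 - p) / r₀)| ≤ |s| / r₀ := by
    rw [abs_mul, abs_div, abs_of_pos hr₀0, zero_sub, abs_neg, abs_of_pos hp₀, mul_div_assoc']
    gcongr; nlinarith [abs_nonneg s]
  have h1 := norm_cexp_sub_taylor_le (hx.trans hr)
  have h2 := norm_cexp_sub_taylor_le (hy.trans hr)
  set x := s * ((1 - p) / r₀) with hxdef
  set y := s * ((0 - p) / r₀) with hydef
  -- Mean zero and variance `s²`: these cancel the Taylor terms of order one and two in the weighted
  -- sum.
  have hm : p * x + (1 - p) * y = 0 := by rw [hxdef, hydef]; field_simp; ring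
  have hv : p * x ^ 2 + (1 - p) * y ^ 2 = s ^ 2 := by
    rw [hxdef, hydef, mul_pow, mul_pow, div_pow, div_pow, hr₀2]
    have : 1 - p ≠ 0 := by linarith
    field_simp; ring
  have hmC : (p : ℂ) * x + (1 - p) * y = 0 := by exact_mod_cast hm
  have hvC : (p : ℂ) * x ^ 2 + (1 - p) * y ^ 2 = s ^ 2 := by exact_mod_cast hv
  have key : (p : ℂ) * Complex.exp (x * Complex.I) + (1 - p) * Complex.exp (y * Complex.I)
      - (1 - (s : ℂ) ^ 2 / 2)
      = ((p : ℝ) : ℂ) * (Complex.exp (x * Complex.I) - (1 + x * Complex.I - (x : ℂ) ^ 2 / 2))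
        + ((1 - p : ℝ) : ℂ) *
          (Complex.exp (y * Complex.I) - (1 + y * Complex.I - (y : ℂ) ^ 2 / 2)) := by
    push_cast
    linear_combination Complex.I * hmC - (1 / 2 : ℂ) * hvC
  rw [key]
  refine (norm_add_le _ _).trans ?_
  rw [norm_mul, norm_mul, Complex.norm_real, Complex.norm_real, Real.norm_of_nonneg hp₀.le,
    Real.norm_of_nonneg (by linarith : 0 ≤ 1 - p)]
  have h3 : |x| ^ 3 ≤ (|s| / r₀) ^ 3 := by gcongr
  have h4 : |y| ^ 3 ≤ (|s| / r₀) ^ 3 := by gcongr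
  nlinarith

lemma charFun_map_stdProp {a b : ℝ} (hab₁ : a ^ 2 + 1 < a * b) (hab₂ : a * b ≤ b ^ 2 + 1)
    (θ : I × I) {n : ℕ} (hn : 1 ≤ n) (t : ℝ) :
    charFun ((electionLaw θ n).map (stdProp a b θ n)) t =
      ((pPost θ : ℂ) * Complex.exp (((t / √n * ((1 - pPost θ) / voteSd (pPost θ)) : ℝ) : ℂ)
          * Complex.I)
        + (1 - pPost θ) * Complex.exp (((t / √n * ((0 - pPost θ) / voteSd (pPost θ)) : ℝ) : ℂ)
          * Complex.I)) ^ n := by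
  rw [charFun_apply_real, integral_map (by fun_prop) (by fun_prop)]
  have : ∀ ω : Fin n → Bool × Bool, Complex.exp (t * (stdProp a b θ n ω : ℝ) * Complex.I)
      = ∏ i, (fun w ↦ Complex.exp (((t / √n * ((postVote a b w - pPost θ) /
        voteSd (pPost θ)) : ℝ) : ℂ) * Complex.I)) (ω i) := by
    intro ω
    simp only
    rw [← Complex.exp_sum, stdProp_eq a b θ hn, ← Finset.sum_mul]
    congr 2
    push_cast
    rw [Finset.mul_sum]
    refine Finset.sum_congr rfl fun i _ ↦ ?_
    ring
  simp_rw [this]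
  rw [electionLaw, integral_fintype_prod_eq_pow (μ := voterLaw θ)
    (fun w ↦ Complex.exp (((t / √n * ((postVote a b w - pPost θ) /
        voteSd (pPost θ)) : ℝ) : ℂ) * Complex.I)), Fintype.card_fin,
    integral_comp_postVote hab₁ hab₂ θ (fun x : ℝ ↦ Complex.exp (((t / √n * ((x - pPost θ) /
        voteSd (pPost θ)) : ℝ) : ℂ) * Complex.I))]
  simp only [Complex.real_smul]
  push_cast
  rfl

/-- The central limit theorem for votes whose probabilities may vary with the number of voters. -/
lemma tendsto_electionLaw_abs_stdProp_lt {a b : ℝ} (hab₁ : a ^ 2 + 1 < a * b)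
    (hab₂ : a * b ≤ b ^ 2 + 1) {s : ℝ} (hs : 0 < s) (θ : ℕ → I × I)
    (hθ : ∀ n, 0 < pPost (θ n) ∧ pPost (θ n) < 1 ∧ s ≤ voteSd (pPost (θ n))) (c : ℝ) :
    Tendsto (fun n ↦ (electionLaw (θ n) n).real {ω | |stdProp a b (θ n) n ω| < c}) atTop
      (𝓝 ((gaussianReal 0 1).real (Set.Ioo (-c) c))) := by
  let μ : ℕ → ProbabilityMeasure ℝ := fun n ↦
    ⟨(electionLaw (θ n) n).map (stdProp a b (θ n) n),
      Measure.isProbabilityMeasure_map (by fun_prop)⟩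
  let ν : ProbabilityMeasure ℝ := ⟨gaussianReal 0 1, inferInstance⟩
  have hconv : Tendsto μ atTop (𝓝 ν) := by
    refine ProbabilityMeasure.tendsto_iff_tendsto_charFun.2 fun t ↦ ?_
    have hν : charFun (ν : Measure ℝ) t = Complex.exp (-(t : ℂ) ^ 2 / 2) := by
      simp only [ν, ProbabilityMeasure.coe_mk, charFun_gaussianReal]
      congr 1
      simp
      ring
    rw [hν]
    have hsq : Tendsto (fun n : ℕ ↦ √(n : ℝ)) atTop atTop :=
      Real.tendsto_sqrt_atTop.comp tendsto_natCast_atTop_atTop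
    set φ : ℕ → ℂ := fun n ↦
      ((pPost (θ n) : ℂ) * Complex.exp (((t / √n * ((1 - pPost (θ n)) / voteSd (pPost (θ n))) : ℝ)
          : ℂ) * Complex.I)
        + (1 - pPost (θ n)) * Complex.exp (((t / √n * ((0 - pPost (θ n)) /
          voteSd (pPost (θ n))) : ℝ) : ℂ) * Complex.I)) with hφ
    have hmain : Tendsto (fun n ↦ φ n ^ n) atTop (𝓝 (Complex.exp (-(t : ℂ) ^ 2 / 2))) := by
      -- It remains to see that the error of one factor is `o(1/n)`. It is at most `(|t| / s)³
      -- n^(-3/2)`, where the common lower bound `s` on the standard deviations replaces a fixed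
      -- law.
      apply Complex.tendsto_pow_exp_of_isLittleO_sub_add_div
      rw [Asymptotics.isLittleO_iff]
      intro ε hε
      have h1 : ∀ᶠ n : ℕ in atTop, |t| / s ≤ √(n : ℝ) := hsq.eventually_ge_atTop _
      have h2 : ∀ᶠ n : ℕ in atTop, (|t| / s) ^ 3 / ε ≤ √(n : ℝ) := hsq.eventually_ge_atTop _
      filter_upwards [h1, h2, eventually_ge_atTop 1] with n h1 h2 hn
      obtain ⟨hp₀, hp₁, hsn⟩ := hθ n
      have hn' : (0 : ℝ) < n := by exact_mod_cast hn
      have hr : 0 < √(n : ℝ) := Real.sqrt_pos.2 hn'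
      have hrr : √(n : ℝ) ^ 2 = n := Real.sq_sqrt hn'.le
      have hsd : 0 < voteSd (pPost (θ n)) := hs.trans_le hsn
      have hts : |t / √n| ≤ voteSd (pPost (θ n)) := by
        rw [abs_div, abs_of_pos hr, div_le_iff₀ hr]
        rw [div_le_iff₀ hs] at h1
        nlinarith
      have h := norm_bernoulli_charFun_sub_le hp₀ hp₁ hts
      have e : (1 - ((t / √n : ℝ) : ℂ) ^ 2 / 2) = 1 + -(t : ℂ) ^ 2 / 2 / n := by
        have : ((√n : ℝ) : ℂ) ^ 2 = n := by exact_mod_cast hrr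
        push_cast
        rw [div_pow, this]; ring
      rw [e] at h
      refine h.trans ?_
      have : ‖(1 / (n : ℂ))‖ = 1 / n := by simp
      rw [this, abs_div, abs_of_pos hr]
      rw [div_le_iff₀ hε] at h2
      calc (|t| / √n / voteSd (pPost (θ n))) ^ 3 ≤ (|t| / √n / s) ^ 3 := by gcongr
        _ = (|t| / s) ^ 3 / √n ^ 3 := by field_simp
        _ ≤ (√n * ε) / √n ^ 3 := by gcongr
        _ = ε * (1 / √n ^ 2) := by field_simp
        _ = ε * (1 / n) := by rw [hrr]
    refine hmain.congr' ?_
    filter_upwards [eventually_ge_atTop 1] with n hn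
    simp only [μ, ProbabilityMeasure.coe_mk]
    exact (charFun_map_stdProp hab₁ hab₂ (θ n) hn t).symm
  have hfr : ν (frontier (Set.Ioo (-c) c)) = 0 := by
    have hcount : (frontier (Set.Ioo (-c) c)).Countable := by
      by_cases hc : -c < c
      · rw [frontier_Ioo hc]; exact (Set.toFinite _).countable
      · simp [Set.Ioo_eq_empty hc]
    rw [ProbabilityMeasure.null_iff_toMeasure_null]
    have : NullSingletonClass (gaussianReal 0 1) := nullSingletonClass_gaussianReal (by simp)
    exact hcount.measure_zero (gaussianReal 0 1)
  have h := ProbabilityMeasure.tendsto_measure_of_null_frontier_of_tendsto hconv hfr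
  have h' := (NNReal.continuous_coe.tendsto _).comp h
  refine (h'.congr fun n ↦ ?_)
  simp only [Function.comp, μ, ProbabilityMeasure.mk_apply]
  rw [Measure.map_apply (by fun_prop) measurableSet_Ioo, ENNReal.coe_toNNReal_eq_toReal]
  congr 2
  ext ω
  simp [abs_lt]

/-! ### The sign function and its Gaussian smoothing -/

/-- The real-valued sign function. -/
noncomputable def sgn (x : ℝ) : ℝ := (SignType.sign x : ℝ)

lemma sgn_of_pos {x : ℝ} (hx : 0 < x) : sgn x = 1 := by simp [sgn, sign_pos hx]

lemma sgn_of_neg {x : ℝ} (hx : x < 0) : sgn x = -1 := by simp [sgn, sign_neg hx]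

@[simp] lemma sgn_zero : sgn 0 = 0 := by simp [sgn]

lemma sgn_neg (x : ℝ) : sgn (-x) = -sgn x := by
  rcases lt_trichotomy x 0 with h | rfl | h
  · rw [sgn_of_neg h, sgn_of_pos (by linarith)]; ring
  · simp
  · rw [sgn_of_pos h, sgn_of_neg (by linarith)]

lemma monotone_sgn : Monotone sgn := by
  intro x y h
  rcases lt_trichotomy x 0 with hx | rfl | hx <;> rcases lt_trichotomy y 0 with hy | rfl | hy <;>
    first
    | linarith
    | simp [sgn_of_pos, sgn_of_neg, *]

@[fun_prop] lemma measurable_sgn : Measurable sgn := monotone_sgn.measurable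

lemma abs_sgn_le (x : ℝ) : |sgn x| ≤ 1 := by
  rcases lt_trichotomy x 0 with hx | rfl | hx <;> simp [sgn_of_pos, sgn_of_neg, *]

/-- The expectation of `sgn (z + W)` for a random variable `W` with law `μ`. -/
noncomputable def sgnMean (μ : Measure ℝ) (z : ℝ) : ℝ := ∫ w, sgn (z + w) ∂μ

lemma integrable_sgn_add (μ : Measure ℝ) [IsFiniteMeasure μ] (z : ℝ) :
    Integrable (fun w ↦ sgn (z + w)) μ :=
  Integrable.of_bound (measurable_sgn.comp (measurable_const_add z)).aestronglyMeasurable 1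
    (.of_forall fun _ ↦ abs_sgn_le _)

lemma abs_sgnMean_le (μ : Measure ℝ) [IsProbabilityMeasure μ] (z : ℝ) : |sgnMean μ z| ≤ 1 := by
  have := norm_integral_le_of_norm_le_const (μ := μ) (f := fun w ↦ sgn (z + w))
    (.of_forall fun w ↦ abs_sgn_le _)
  simpa [sgnMean] using this

/-- Between `y` and `z` the integrand jumps by 2 on `(-z, -y)`, and a nondegenerate Gaussian charges
every interval of positive length. -/
lemma strictMono_sgnMean_gaussianReal (m : ℝ) {v : NNReal} (hv : v ≠ 0) :
    StrictMono (sgnMean (gaussianReal m v)) := by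
  intro y z hyz
  rw [← sub_pos, sgnMean, sgnMean, ← integral_sub (integrable_sgn_add _ _) (integrable_sgn_add _ _)]
  rw [integral_pos_iff_support_of_nonneg]
  · have hsub : Set.Ioo (-z) (-y) ⊆ Function.support fun w ↦ sgn (z + w) - sgn (y + w) := by
      rintro w ⟨h1, h2⟩
      rw [Function.mem_support, sgn_of_pos (by linarith), sgn_of_neg (by linarith)]
      norm_num
    refine lt_of_lt_of_le ?_ (measure_mono hsub)
    rw [pos_iff_ne_zero]
    intro h0
    have := gaussianReal_absolutelyContinuous' m hv h0
    simp at this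
    linarith
  · intro w
    exact sub_nonneg.2 (monotone_sgn (by linarith))
  · exact (integrable_sgn_add _ _).sub (integrable_sgn_add _ _)

lemma sgnMean_gaussianReal_zero {v : NNReal} : sgnMean (gaussianReal 0 v) 0 = 0 := by
  have h : ∫ w, sgn w ∂gaussianReal 0 v = -∫ w, sgn w ∂gaussianReal 0 v := by
    conv_lhs => rw [show gaussianReal 0 v = (gaussianReal 0 v).map (fun x ↦ -x) by
      rw [gaussianReal_map_neg, neg_zero]]
    rw [integral_map (by fun_prop) (by fun_prop)]
    simp only [sgn_neg, integral_neg]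
  simp only [sgnMean, zero_add]
  linarith

lemma sgnMean_gaussianReal_zero_nonneg {m : ℝ} (hm : 0 ≤ m) {v : NNReal} (hv : v ≠ 0) :
    0 ≤ sgnMean (gaussianReal m v) 0 := by
  have : sgnMean (gaussianReal m v) 0 = sgnMean (gaussianReal 0 v) m := by
    have h : gaussianReal m v = (gaussianReal 0 v).map (fun x ↦ m + x) := by
      rw [gaussianReal_map_const_add, zero_add]
    simp only [h, sgnMean, zero_add]
    rw [integral_map (by fun_prop) (by fun_prop)]
  refine this ▸ (sgnMean_gaussianReal_zero (v := v)).ge.trans ?_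
  exact (strictMono_sgnMean_gaussianReal 0 hv).monotone hm

/-! ### A reflection argument -/

lemma integral_prod_gaussianReal {m₁ m₂ : ℝ} {v₁ v₂ : NNReal} (h₁ : v₁ ≠ 0) (h₂ : v₂ ≠ 0)
    (F : ℝ × ℝ → ℝ) :
    ∫ y, F y ∂(gaussianReal m₁ v₁).prod (gaussianReal m₂ v₂) =
      ∫ y : ℝ × ℝ, gaussianPDFReal m₁ v₁ y.1 * gaussianPDFReal m₂ v₂ y.2 * F y := by
  rw [gaussianReal_of_var_ne_zero _ h₁, gaussianReal_of_var_ne_zero _ h₂,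
    prod_withDensity (measurable_gaussianPDF _ _) (measurable_gaussianPDF _ _),
    integral_withDensity_eq_integral_toReal_smul]
  · simp [ENNReal.toReal_mul, toReal_gaussianPDF, Measure.volume_eq_prod]
  · fun_prop
  · refine .of_forall fun y ↦ ENNReal.mul_lt_top ?_ ?_ <;> exact gaussianPDF_lt_top

/-- Two independent increments of a Brownian motion with drift `c` that starts at `-c`: a path that
first ends below and then above `0` is at least as likely as its reflection. -/
lemma gaussianPDFReal_mul_reflect_le {c x b : ℝ} (hc : 0 ≤ c) {o d : NNReal} (ho : o ≠ 0)
    (hd : d ≠ 0) (hx : x ≤ 0) (hz : 0 ≤ x + b) :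
    gaussianPDFReal (c * (o - 1)) o (-x) * gaussianPDFReal (c * d) d (-b) ≤
      gaussianPDFReal (c * (o - 1)) o x * gaussianPDFReal (c * d) d b := by
  have ho' : (0 : ℝ) < o := by positivity
  have hd' : (0 : ℝ) < d := by positivity
  simp only [gaussianPDFReal]
  rw [mul_mul_mul_comm, mul_mul_mul_comm (√(2 * Real.pi * o))⁻¹ (Real.exp (-(x - _) ^ 2 / _))]
  rw [← Real.exp_add, ← Real.exp_add]
  refine mul_le_mul_of_nonneg_left (Real.exp_le_exp.2 ?_) (by positivity)
  -- The logarithm of the likelihood ratio. The term `2c(x + b)` comes from the drift and `2c(-x)/o`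
  -- from the start at `-c`; both are nonnegative for an upward crossing.
  have : -(x - c * (o - 1)) ^ 2 / (2 * o) + -(b - c * d) ^ 2 / (2 * d)
      - (-(-x - c * (o - 1)) ^ 2 / (2 * o) + -(-b - c * d) ^ 2 / (2 * d))
      = 2 * c * (x + b) + 2 * c * (-x) / o := by
    field_simp; ring
  have h1 : 0 ≤ 2 * c * (x + b) := by positivity
  have h2 : 0 ≤ 2 * c * (-x) / o := by
    have : 0 ≤ -x := by linarith
    positivity
  linarith

/-- The factor `sgn (x + b) - sgn x` is odd under `(x, b) ↦ (-x, -b)`, so symmetrizing the integral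
compares `k(z) P` with `k(-z) P'`, where `z = x + b` and `P'` is the reflected density. On an upward
crossing `P ≥ P'`, `k(z) > k(-z)` and `k(z) ≥ 0`, which fixes the sign. -/
lemma integral_sgn_sub_mul_pos {c : ℝ} (hc : 0 ≤ c) {o d : NNReal} (ho : o ≠ 0) (hd : d ≠ 0)
    {k : ℝ → ℝ} (hk : StrictMono k) (hk0 : 0 ≤ k 0) {B : ℝ} (hkB : ∀ z, |k z| ≤ B) :
    0 < ∫ y, (sgn (y.1 + y.2) - sgn y.1) * k (y.1 + y.2)
      ∂(gaussianReal (c * (o - 1)) o).prod (gaussianReal (c * d) d) := by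
  have hkm : Measurable k := hk.monotone.measurable
  rw [integral_prod_gaussianReal ho hd]
  set P : ℝ × ℝ → ℝ := fun y ↦ gaussianPDFReal (c * (o - 1)) o y.1 * gaussianPDFReal (c * d) d y.2
    with hP
  set G : ℝ × ℝ → ℝ := fun y ↦ P y * ((sgn (y.1 + y.2) - sgn y.1) * k (y.1 + y.2)) with hG
  change 0 < ∫ y, G y
  have hPpos : ∀ y, 0 < P y := fun y ↦
    mul_pos (gaussianPDFReal_pos _ _ _ ho) (gaussianPDFReal_pos _ _ _ hd)
  have hPint : Integrable P :=
    (integrable_gaussianPDFReal _ _).mul_prod (integrable_gaussianPDFReal _ _)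
  have hGint : Integrable G := by
    refine Integrable.mul_bdd (c := 2 * B) hPint (by fun_prop) (.of_forall fun y ↦ ?_)
    rw [norm_mul]
    have h1 : ‖sgn (y.1 + y.2) - sgn y.1‖ ≤ 2 := by
      refine (norm_sub_le _ _).trans ?_
      have := abs_sgn_le (y.1 + y.2); have := abs_sgn_le y.1
      rw [Real.norm_eq_abs, Real.norm_eq_abs]; linarith
    exact mul_le_mul h1 (hkB _) (norm_nonneg _) (by norm_num)
  have hsum : ∀ x b : ℝ, G (x, b) + G (-x, -b) = (sgn (x + b) - sgn x) *
      (k (x + b) * P (x, b) - k (-(x + b)) * P (-x, -b)) := by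
    intro x b
    have : -x + -b = -(x + b) := by ring
    simp only [hG, this, sgn_neg]
    ring
  have hkpos : ∀ z, 0 ≤ z → 0 ≤ k z := fun z hz ↦ hk0.trans (hk.monotone hz)
  have hbr : ∀ x b : ℝ, x ≤ 0 → 0 ≤ x + b →
      0 ≤ k (x + b) * P (x, b) - k (-(x + b)) * P (-x, -b) := by
    intro x b hx hz
    have h1 : P (-x, -b) ≤ P (x, b) := gaussianPDFReal_mul_reflect_le hc ho hd hx hz
    have h2 : k (-(x + b)) ≤ k (x + b) := hk.monotone (by linarith)
    have h3 := hkpos _ hz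
    have h4 := hPpos (-x, -b)
    nlinarith
  have hhalf : ∀ x b : ℝ, x ≤ 0 → 0 ≤ x + b → 0 ≤ G (x, b) + G (-x, -b) := by
    intro x b hx hz
    rw [hsum]
    exact mul_nonneg (sub_nonneg.2 (monotone_sgn (by linarith))) (hbr x b hx hz)
  -- Downward crossings are the reflections of upward ones, and without a crossing the sign
  -- difference vanishes; the remaining cases are paths that meet `0` at one of the two times.
  have hnonneg : ∀ y : ℝ × ℝ, 0 ≤ G y + G (-y) := by
    rintro ⟨x, b⟩
    change 0 ≤ G (x, b) + G (-x, -b)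
    rcases le_total x 0 with hx | hx <;> rcases le_total 0 (x + b) with hz | hz
    · exact hhalf x b hx hz
    · rcases hx.eq_or_lt with rfl | hx'
      · have h := hhalf (-0) (-b) (by simp) (by linarith)
        simp only [neg_neg] at h
        linarith
      · rcases hz.eq_or_lt with hz' | hz'
        · exact hhalf x b hx hz'.ge
        · rw [hsum, sgn_of_neg hx', sgn_of_neg hz']; simp
    · rcases hx.eq_or_lt with rfl | hx'
      · exact hhalf 0 b le_rfl hz
      · rcases hz.eq_or_lt with hz' | hz'
        · have h := hhalf (-x) (-b) (by linarith) (by linarith)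
          simp only [neg_neg] at h
          linarith
        · rw [hsum, sgn_of_pos hx', sgn_of_pos hz']; simp
    · have h := hhalf (-x) (-b) (by linarith) (by linarith)
      simp only [neg_neg] at h
      linarith
  have hneg : ∫ y, G (-y) = ∫ y, G y := integral_neg_eq_self G volume
  have h2 : 0 < ∫ y, (G y + G (-y)) := by
    rw [integral_pos_iff_support_of_nonneg hnonneg (hGint.add hGint.comp_neg)]
    -- A box of strict upward crossings, of positive volume, makes the inequality strict.
    have hsub : Set.Ioo (-1 : ℝ) 0 ×ˢ Set.Ioo (1 : ℝ) 2 ⊆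
        Function.support fun y ↦ G y + G (-y) := by
      rintro ⟨x, b⟩ ⟨⟨hx1, hx2⟩, hb1, hb2⟩
      simp only at hx1 hx2 hb1 hb2
      have hz : 0 < x + b := by linarith
      change G (x, b) + G (-x, -b) ≠ 0
      rw [hsum, sgn_of_pos hz, sgn_of_neg hx2]
      have h1 : P (-x, -b) ≤ P (x, b) := gaussianPDFReal_mul_reflect_le hc ho hd hx2.le hz.le
      have h2 : k (-(x + b)) < k (x + b) := hk (by linarith)
      have h3 := hkpos _ hz.le
      have h4 := hPpos (-x, -b)
      have : 0 < k (x + b) * P (x, b) - k (-(x + b)) * P (-x, -b) := by nlinarith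
      nlinarith
    refine lt_of_lt_of_le ?_ (measure_mono hsub)
    rw [Measure.volume_eq_prod, Measure.prod_prod]
    simp
  rw [integral_add hGint hGint.comp_neg, hneg] at h2
  linarith

/-! ### The probability of an unchanged majority -/

/-- The quadratic form is a combination of squares with weights `(1 - p₀) p'`, `(1 - p₀)(p₀ - p')`
and `p' (p₀ - p')`. Positive semidefiniteness is what gives `multivariateGaussian` its usual
characteristic function and variances. -/
lemma posSemidef_Sigma2 {p₀ p' : ℝ} (h₀ : 0 ≤ p') (h₁ : p' ≤ p₀) (h₂ : p₀ ≤ 1) (n : ℕ) :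
    ((n : ℝ)⁻¹ • Sigma2 p₀ p').PosSemidef := by
  refine Matrix.PosSemidef.smul ?_ (by positivity)
  refine Matrix.PosSemidef.of_dotProduct_mulVec_nonneg ?_ fun x ↦ ?_
  · ext i j; fin_cases i <;> fin_cases j <;> simp [Sigma2]
  · have : star x ⬝ᵥ Matrix.mulVec (Sigma2 p₀ p') x = 4 * ((1 - p₀) * p' * (x 0 + x 1) ^ 2
        + (1 - p₀) * (p₀ - p') * x 0 ^ 2 + p' * (p₀ - p') * x 1 ^ 2) := by
      simp [Sigma2, Matrix.mulVec, dotProduct, Fin.sum_univ_two]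
      ring
    rw [this]
    have h3 : 0 ≤ 1 - p₀ := by linarith
    have h4 : 0 ≤ p₀ - p' := by linarith
    positivity

lemma eta_nonneg (p₀ p' : ℝ) (n : ℕ) : 0 ≤ eta p₀ p' n := measureReal_nonneg

lemma eta_le_one (p₀ p' : ℝ) (n : ℕ) : eta p₀ p' n ≤ 1 := measureReal_le_one

/-- The pair of components as a linear function of two independent increments of a Brownian motion
in the time scale of the odds `p / (1 - p)`. -/
noncomputable def oddsMap (n : ℕ) (o d : ℝ) (y : ℝ × ℝ) : EuclideanSpace ℝ (Fin 2) :=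
  !₂[2 / (√n * (1 + o + d)) * (y.1 + y.2), 2 / (√n * (1 + o)) * y.1]

lemma measurable_oddsMap (n : ℕ) (o d : ℝ) : Measurable (oddsMap n o d) := by
  have : Continuous (oddsMap n o d) := by
    unfold oddsMap
    refine (PiLp.continuous_toLp 2 _).comp (continuous_pi fun i ↦ ?_)
    fin_cases i <;> simp <;> fun_prop
  exact this.measurable

/-- With `p = s / (1 + s)` one has `2p - 1 = (s - 1) / (1 + s)`, and the covariance `4 p' (1 - p₀)`
is `4 o / ((1 + o)(1 + o + d))`. Up to the factors `1 / (1 + s)` this is the covariance `min` of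
Brownian motion, so characteristic functions agree. -/
lemma multivariateGaussian_eq_map_oddsMap {n : ℕ} (hn : 1 ≤ n) (o d : NNReal) :
    multivariateGaussian (mu2 ((o + d) / (1 + o + d)) (o / (1 + o)))
      ((n : ℝ)⁻¹ • Sigma2 ((o + d) / (1 + o + d)) (o / (1 + o))) =
    ((gaussianReal (√n / 2 * (o - 1)) o).prod (gaussianReal (√n / 2 * d) d)).map
      (oddsMap n o d) := by
  have hn' : (0 : ℝ) < n := by exact_mod_cast hn
  have hs : 0 < √(n : ℝ) := Real.sqrt_pos.2 hn'
  have hss : √(n : ℝ) ^ 2 = n := Real.sq_sqrt hn'.le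
  have ho0 : (0 : ℝ) ≤ o := o.2
  have hd0 : (0 : ℝ) ≤ d := d.2
  have : IsProbabilityMeasure (((gaussianReal (√n / 2 * (o - 1)) o).prod
      (gaussianReal (√n / 2 * d) d)).map (oddsMap n o d)) :=
    Measure.isProbabilityMeasure_map (measurable_oddsMap _ _ _).aemeasurable
  apply Measure.ext_of_charFun
  ext t
  rw [charFun_multivariateGaussian (posSemidef_Sigma2 (by positivity) (by
      rw [div_le_div_iff₀ (by positivity) (by positivity)]; nlinarith) (by
      rw [div_le_one (by positivity)]; linarith) n), charFun_apply,
    integral_map (measurable_oddsMap _ _ _).aemeasurable (by fun_prop)]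
  set κ₀ : ℝ := 2 / (√n * (1 + o + d)) with hκ₀
  set κ₁ : ℝ := 2 / (√n * (1 + o)) with hκ₁
  have hsplit : ∀ y : ℝ × ℝ, Complex.exp ((inner ℝ (oddsMap n o d y) t : ℝ) * Complex.I) =
      Complex.exp (((t 0 * κ₀ + t 1 * κ₁ : ℝ) : ℂ) * (y.1 : ℂ) * Complex.I) *
      Complex.exp (((t 0 * κ₀ : ℝ) : ℂ) * (y.2 : ℂ) * Complex.I) := by
    intro y
    rw [← Complex.exp_add]
    congr 1
    have : (inner ℝ (oddsMap n o d y) t : ℝ) =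
        (t 0 * κ₀ + t 1 * κ₁) * y.1 + t 0 * κ₀ * y.2 := by
      simp [oddsMap, PiLp.inner_apply, Fin.sum_univ_two]
      ring
    rw [this]
    push_cast
    ring
  simp_rw [hsplit]
  rw [integral_prod_mul (fun x : ℝ ↦ Complex.exp (((t 0 * κ₀ + t 1 * κ₁ : ℝ) : ℂ) * (x : ℂ) *
      Complex.I)) (fun x : ℝ ↦ Complex.exp (((t 0 * κ₀ : ℝ) : ℂ) * (x : ℂ) * Complex.I)),
    ← charFun_apply_real, ← charFun_apply_real, charFun_gaussianReal, charFun_gaussianReal,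
    ← Complex.exp_add]
  congr 1
  have hmean : (inner ℝ t (mu2 ((o + d) / (1 + o + d)) (o / (1 + o))) : ℝ) =
      (t 0 * κ₀ + t 1 * κ₁) * (√n / 2 * (o - 1)) + t 0 * κ₀ * (√n / 2 * d) := by
    simp only [mu2, PiLp.inner_apply, Fin.sum_univ_two, hκ₀, hκ₁]
    simp
    field_simp
    ring
  have hcov : (t.ofLp ⬝ᵥ Matrix.mulVec ((n : ℝ)⁻¹ • Sigma2 ((o + d) / (1 + o + d)) (o / (1 + o)))
      t.ofLp : ℝ) = o * (t 0 * κ₀ + t 1 * κ₁) ^ 2 + d * (t 0 * κ₀) ^ 2 := by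
    have hninv : (n : ℝ)⁻¹ = (√n ^ 2)⁻¹ := by rw [hss]
    rw [hninv]
    simp only [Sigma2, Matrix.mulVec, dotProduct, Fin.sum_univ_two, hκ₀, hκ₁]
    simp only [Matrix.smul_apply, Matrix.of_apply, Matrix.cons_val', Matrix.cons_val_zero,
      Matrix.cons_val_one, Matrix.cons_val_fin_one, smul_eq_mul]
    field_simp
    ring
  rw [hmean, hcov]
  push_cast
  ring

lemma sign_mul_of_pos {κ x : ℝ} (hκ : 0 < κ) : SignType.sign (κ * x) = SignType.sign x := by
  rw [sign_mul, sign_pos hκ, one_mul]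

lemma indicator_sign_eq {x y : ℝ} (hx : x ≠ 0) (hy : y ≠ 0) :
    ({p : ℝ × ℝ | SignType.sign p.1 = SignType.sign p.2}.indicator (fun _ ↦ (1 : ℝ)) (x, y)) =
      (1 + sgn x * sgn y) / 2 := by
  rcases hx.lt_or_gt with hx | hx <;> rcases hy.lt_or_gt with hy | hy <;>
    simp [Set.indicator, sgn_of_pos, sgn_of_neg, sign_pos, sign_neg, hx, hy]

lemma integrable_sgn_mul_sgn (μ : Measure (ℝ × ℝ)) [IsFiniteMeasure μ] :
    Integrable (fun y ↦ sgn y.1 * sgn (y.1 + y.2)) μ := by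
  refine Integrable.of_bound (Measurable.aestronglyMeasurable (by fun_prop)) 1
    (.of_forall fun y ↦ ?_)
  rw [norm_mul]
  exact mul_le_one₀ (abs_sgn_le _) (norm_nonneg _) (abs_sgn_le _)

/-- Positive scalings do not affect signs, so only the Brownian increments matter. Off the null set
where a component vanishes, the indicator of equal signs is `(1 + sgn · sgn) / 2`, and the later
increment is integrated out first. -/
lemma eta_odds {n : ℕ} (hn : 1 ≤ n) {o d : NNReal} (ho : o ≠ 0) (hd : d ≠ 0) :
    eta ((o + d) / (1 + o + d)) (o / (1 + o)) n =
      (1 + ∫ x, sgn x * sgnMean (gaussianReal (√n / 2 * d) d) x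
        ∂gaussianReal (√n / 2 * (o - 1)) o) / 2 := by
  have hn' : (0 : ℝ) < n := by exact_mod_cast hn
  have hs : 0 < √(n : ℝ) := Real.sqrt_pos.2 hn'
  have ho0 : (0 : ℝ) < o := by positivity
  have hd0 : (0 : ℝ) < d := by positivity
  set μ := gaussianReal (√n / 2 * (o - 1)) o with hμ
  set ν := gaussianReal (√n / 2 * d) d with hν
  have hset : MeasurableSet {p : ℝ × ℝ | SignType.sign p.1 = SignType.sign p.2} := by
    have : {p : ℝ × ℝ | SignType.sign p.1 = SignType.sign p.2} =
        {p : ℝ × ℝ | sgn p.1 = sgn p.2} := by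
      ext p
      simp only [Set.mem_ofPred_eq, sgn]
      generalize SignType.sign p.1 = x
      generalize SignType.sign p.2 = y
      rcases x with _ | _ | _ <;> rcases y with _ | _ | _ <;> simp <;>
        first | decide | norm_num
    rw [this]
    exact measurableSet_eq_fun (by fun_prop) (by fun_prop)
  have hpull : Measurable fun y : EuclideanSpace ℝ (Fin 2) ↦ (y 0, y 1) := by fun_prop
  have hset' : MeasurableSet {x : EuclideanSpace ℝ (Fin 2) |
      SignType.sign (x 0) = SignType.sign (x 1)} := hpull hset
  have hadd : Measurable fun y : ℝ × ℝ ↦ (y.1, y.1 + y.2) := by fun_prop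
  rw [eta, f, multivariateGaussian_eq_map_oddsMap hn, map_measureReal_apply
    (measurable_oddsMap _ _ _) hset']
  have hpre : oddsMap n o d ⁻¹' {x : EuclideanSpace ℝ (Fin 2) |
      SignType.sign (x 0) = SignType.sign (x 1)} = (fun y : ℝ × ℝ ↦ (y.1, y.1 + y.2)) ⁻¹'
        {p : ℝ × ℝ | SignType.sign p.1 = SignType.sign p.2} := by
    ext y
    simp only [oddsMap, Set.mem_preimage, Set.mem_ofPred_eq]
    simp only [Matrix.cons_val_zero, Matrix.cons_val_one]
    rw [sign_mul_of_pos (by positivity), sign_mul_of_pos (by positivity)]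
    exact eq_comm
  rw [hpre, ← integral_indicator_one (hadd hset)]
  have hae1 : ∀ᵐ y ∂μ.prod ν, y.1 ≠ 0 := by
    have : NullSingletonClass μ := nullSingletonClass_gaussianReal ho
    have h0 : ∀ᵐ x ∂μ, x ≠ 0 := by simp [ae_iff]
    exact Measure.quasiMeasurePreserving_fst.ae h0
  have hae2 : ∀ᵐ y ∂μ.prod ν, y.1 + y.2 ≠ 0 := by
    have hc : (μ.prod ν).map (fun y ↦ y.1 + y.2) = gaussianReal (√n / 2 * (o - 1) + √n / 2 * d)
        (o + d) := gaussianReal_conv_gaussianReal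
    have : NullSingletonClass ((μ.prod ν).map (fun y ↦ y.1 + y.2)) :=
      hc ▸ nullSingletonClass_gaussianReal (by positivity)
    have h0 : ∀ᵐ x ∂(μ.prod ν).map (fun y ↦ y.1 + y.2), x ≠ 0 := by simp [ae_iff]
    exact ae_of_ae_map (f := fun y : ℝ × ℝ ↦ y.1 + y.2) (by fun_prop) h0
  have hind : ∀ᵐ y ∂μ.prod ν, ((fun y : ℝ × ℝ ↦ (y.1, y.1 + y.2)) ⁻¹'
        {p : ℝ × ℝ | SignType.sign p.1 = SignType.sign p.2}).indicator (1 : ℝ × ℝ → ℝ) y =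
        (1 + sgn y.1 * sgn (y.1 + y.2)) / 2 := by
    filter_upwards [hae1, hae2] with y h1 h2
    exact indicator_sign_eq h1 h2
  rw [integral_congr_ae hind, integral_div, integral_add (integrable_const _)
    (integrable_sgn_mul_sgn _), integral_prod _ (integrable_sgn_mul_sgn _)]
  simp [integral_const_mul, sgnMean]

/-! ### Strict monotonicity of `η` in `p'` -/

lemma integrable_sgnMean {μ : Measure ℝ} [IsFiniteMeasure μ] {ν : Measure ℝ}
    [IsProbabilityMeasure ν] : Integrable (fun z ↦ sgn z * sgnMean ν z) μ := by
  have hm : Monotone (sgnMean ν) := fun x y h ↦ integral_mono (integrable_sgn_add _ _)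
    (integrable_sgn_add _ _) fun w ↦ monotone_sgn (by linarith)
  have := hm.measurable
  refine Integrable.of_bound (Measurable.aestronglyMeasurable (by fun_prop)) 1
    (.of_forall fun z ↦ ?_)
  rw [norm_mul]
  exact mul_le_one₀ (abs_sgn_le _) (norm_nonneg _) (abs_sgnMean_le _ _)

lemma sgnMean_conv (μ ν : Measure ℝ) [IsProbabilityMeasure μ] [IsProbabilityMeasure ν] (x : ℝ) :
    sgnMean (μ ∗ ν) x = ∫ b, sgnMean ν (x + b) ∂μ := by
  rw [sgnMean, integral_conv (integrable_sgn_add _ _)]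
  simp only [sgnMean, add_assoc]

/-- Splitting the path at the times `o`, `o + d`, `o + d + e` turns twice the difference of the two
sides into the integral of `integral_sgn_sub_mul_pos`, with `k` the expected sign after the last
increment. That increment has nonnegative drift, hence `k 0 ≥ 0`. -/
lemma eta_odds_lt {n : ℕ} (hn : 1 ≤ n) {o d e : NNReal} (ho : o ≠ 0) (hd : d ≠ 0) (he : e ≠ 0) :
    eta ((o + d + e) / (1 + o + d + e)) (o / (1 + o)) n <
      eta ((o + d + e) / (1 + o + d + e)) ((o + d) / (1 + o + d)) n := by
  have h1 := eta_odds hn (o := o) (d := d + e) ho (by positivity)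
  have h2 := eta_odds hn (o := o + d) (d := e) (by positivity) he
  push_cast at h1 h2
  rw [← add_assoc, ← add_assoc] at h1
  rw [← add_assoc] at h2
  rw [h1, h2]
  set c := √(n : ℝ) / 2 with hc
  have hc0 : 0 ≤ c := by positivity
  set μ := gaussianReal (c * (o - 1)) o with hμ
  set ν := gaussianReal (c * d) d with hν
  set ρ := gaussianReal (c * e) e with hρ
  have e1 : gaussianReal (c * (d + e)) (d + e) = ν ∗ ρ := by
    rw [hν, hρ, gaussianReal_conv_gaussianReal, mul_add]
  have e2 : gaussianReal (c * (o + d - 1)) (o + d) = μ ∗ ν := by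
    rw [hμ, hν, gaussianReal_conv_gaussianReal]; congr 1; ring
  rw [e1, e2, integral_conv integrable_sgnMean]
  simp only [sgnMean_conv]
  have hk := strictMono_sgnMean_gaussianReal (c * e) he
  have hkm := hk.monotone.measurable
  have hpos := integral_sgn_sub_mul_pos hc0 ho hd hk
    (sgnMean_gaussianReal_zero_nonneg (by positivity) he) (abs_sgnMean_le _)
  have hi1 : Integrable (fun y : ℝ × ℝ ↦ sgn (y.1 + y.2) * sgnMean ρ (y.1 + y.2)) (μ.prod ν) := by
    refine Integrable.of_bound (Measurable.aestronglyMeasurable (by fun_prop)) 1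
      (.of_forall fun z ↦ ?_)
    rw [norm_mul]
    exact mul_le_one₀ (abs_sgn_le _) (norm_nonneg _) (abs_sgnMean_le _ _)
  have hi2 : Integrable (fun y : ℝ × ℝ ↦ sgn y.1 * sgnMean ρ (y.1 + y.2)) (μ.prod ν) := by
    refine Integrable.of_bound (Measurable.aestronglyMeasurable (by fun_prop)) 1
      (.of_forall fun z ↦ ?_)
    rw [norm_mul]
    exact mul_le_one₀ (abs_sgn_le _) (norm_nonneg _) (abs_sgnMean_le _ _)
  simp only [sub_mul] at hpos
  rw [integral_sub hi1 hi2, integral_prod _ hi1, integral_prod _ hi2] at hpos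
  simp only [integral_const_mul] at hpos
  linarith

/-- The probability of an unchanged majority is strictly increasing in `p'`. -/
lemma eta_strictMono_right {n : ℕ} (hn : 1 ≤ n) {p₀ p' q' : ℝ} (h₀ : 0 < p') (h₁ : p' < q')
    (h₂ : q' < p₀) (h₃ : p₀ < 1) : eta p₀ p' n < eta p₀ q' n := by
  have a1 : 0 < 1 - p' := by linarith
  have a2 : 0 < 1 - q' := by linarith
  have a3 : 0 < 1 - p₀ := by linarith
  have hd : 0 < q' / (1 - q') - p' / (1 - p') := by
    rw [sub_pos, div_lt_div_iff₀ a1 a2]; nlinarith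
  have he : 0 < p₀ / (1 - p₀) - q' / (1 - q') := by
    rw [sub_pos, div_lt_div_iff₀ a2 a3]; nlinarith
  have ho : 0 < p' / (1 - p') := by positivity
  obtain ⟨o, hoX⟩ : ∃ o : NNReal, (o : ℝ) = p' / (1 - p') := ⟨⟨_, ho.le⟩, rfl⟩
  obtain ⟨d, hdX⟩ : ∃ d : NNReal, (d : ℝ) = q' / (1 - q') - p' / (1 - p') := ⟨⟨_, hd.le⟩, rfl⟩
  obtain ⟨e, heX⟩ : ∃ e : NNReal, (e : ℝ) = p₀ / (1 - p₀) - q' / (1 - q') := ⟨⟨_, he.le⟩, rfl⟩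
  rw [← hoX, NNReal.coe_pos] at ho
  rw [← hdX, NNReal.coe_pos] at hd
  rw [← heX, NNReal.coe_pos] at he
  have h := eta_odds_lt hn ho.ne' hd.ne' he.ne'
  rw [hoX, hdX, heX] at h
  have hodds : ∀ p : ℝ, 0 < 1 - p → p / (1 - p) / (1 + p / (1 - p)) = p := by
    intro p hp
    have : 1 + p / (1 - p) = 1 / (1 - p) := by field_simp; ring
    rw [this]; field_simp
  have s1 : p' / (1 - p') + (q' / (1 - q') - p' / (1 - p')) = q' / (1 - q') := by ring
  have s2 : p' / (1 - p') + (q' / (1 - q') - p' / (1 - p')) + (p₀ / (1 - p₀) - q' / (1 - q'))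
    = p₀ / (1 - p₀) := by ring
  have s3 : 1 + p' / (1 - p') + (q' / (1 - q') - p' / (1 - p')) = 1 + q' / (1 - q') := by ring
  have s4 : 1 + p' / (1 - p') + (q' / (1 - q') - p' / (1 - p')) + (p₀ / (1 - p₀) - q' / (1 - q'))
    = 1 + p₀ / (1 - p₀) := by ring
  rwa [s4, s2, s3, s1, hodds _ a1, hodds _ a2, hodds _ a3] at h

/-- When the two means lie on different sides of `0`, an unchanged majority is unlikely. -/
lemma eta_le_of_opposite {n : ℕ} (hn : 1 ≤ n) {p₀ p' d : ℝ} (h₀ : 0 ≤ p') (h₂ : p₀ ≤ 1)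
    (hd : 0 < d) (hp₀ : d ≤ 2 * p₀ - 1) (hp' : 2 * p' - 1 ≤ -d) :
    eta p₀ p' n ≤ 2 / (n * d ^ 2) := by
  have hn' : (0 : ℝ) < n := by exact_mod_cast hn
  have hS := posSemidef_Sigma2 h₀ (by linarith : p' ≤ p₀) h₂ n
  set P := multivariateGaussian (mu2 p₀ p') ((n : ℝ)⁻¹ • Sigma2 p₀ p') with hP
  have hcheb : ∀ i : Fin 2, P.real {x | d ≤ |x i - mu2 p₀ p' i|} ≤ 1 / (n * d ^ 2) := by
    intro i
    have hL : MemLp (fun x : EuclideanSpace ℝ (Fin 2) ↦ x i) 2 P :=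
      (IsGaussian.memLp_two_id (μ := P)).continuousLinearMap_comp
        (EuclideanSpace.proj (𝕜 := ℝ) i)
    have hmean : ∫ x, x i ∂P = mu2 p₀ p' i := by
      have := ContinuousLinearMap.integral_comp_id_comm (μ := P) IsGaussian.integrable_id
        (EuclideanSpace.proj (𝕜 := ℝ) i)
      simpa [hP] using this
    have hvar : Var[fun x : EuclideanSpace ℝ (Fin 2) ↦ x i; P] ≤ 1 / n := by
      rw [hP, variance_eval_multivariateGaussian hS]
      have : Sigma2 p₀ p' i i ≤ 1 := by
        fin_cases i
        · simp [Sigma2]; nlinarith [sq_nonneg (2 * p₀ - 1)]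
        · simp [Sigma2]; nlinarith [sq_nonneg (2 * p' - 1)]
      rw [Matrix.smul_apply, smul_eq_mul, one_div]
      exact mul_le_of_le_one_right (by positivity) this
    have h := meas_ge_le_variance_div_sq hL hd
    rw [hmean] at h
    refine (ENNReal.toReal_le_of_le_ofReal (div_nonneg (variance_nonneg _ _) (sq_nonneg d))
      h).trans ?_
    calc Var[fun x : EuclideanSpace ℝ (Fin 2) ↦ x i; P] / d ^ 2 ≤ 1 / n / d ^ 2 := by gcongr
      _ = 1 / (n * d ^ 2) := by rw [div_div]
  -- If both components stay within `d` of their means, the first is positive and the second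
  -- negative.
  have hsub : {x : EuclideanSpace ℝ (Fin 2) | SignType.sign (x 0) = SignType.sign (x 1)} ⊆
      {x | d ≤ |x 0 - mu2 p₀ p' 0|} ∪ {x | d ≤ |x 1 - mu2 p₀ p' 1|} := by
    intro x hx
    by_contra hcon
    simp only [Set.mem_union, Set.mem_ofPred_eq, not_or, not_le, abs_lt] at hcon hx
    simp only [mu2, PiLp.toLp_apply, Matrix.cons_val_zero, Matrix.cons_val_one] at hcon
    obtain ⟨⟨h1, -⟩, -, h2⟩ := hcon
    rw [sign_pos (by linarith), sign_neg (by linarith)] at hx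
    exact absurd hx (by decide)
  calc eta p₀ p' n ≤ P.real ({x | d ≤ |x 0 - mu2 p₀ p' 0|} ∪ {x | d ≤ |x 1 - mu2 p₀ p' 1|}) :=
        measureReal_mono hsub
    _ ≤ 1 / (n * d ^ 2) + 1 / (n * d ^ 2) :=
        (measureReal_union_le _ _).trans (add_le_add (hcheb 0) (hcheb 1))
    _ = 2 / (n * d ^ 2) := by ring

/-! ### The cost function -/

variable {h : ℝ → ℝ}

lemma IsCostDensity.integrable (hh : IsCostDensity h) : Integrable h := by
  have h1 : IntegrableOn h (Set.Icc 0 1) := hh.continuousOn.integrableOn_Icc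
  refine h1.integrable_of_forall_notMem_eq_zero fun t ht ↦ hh.eq_zero t ht

lemma IsCostDensity.H_eq (hh : IsCostDensity h) (y : ℝ) : H h y = ∫ t in (0 : ℝ)..y, h t := by
  have h1 : ∫ t in Set.Iic (0 : ℝ), h t = 0 := by
    rw [integral_Iic_eq_integral_Iio]
    refine setIntegral_eq_zero_of_forall_eq_zero fun t ht ↦ hh.eq_zero t fun ht' ↦ ?_
    exact absurd ht'.1 (not_le.2 ht)
  rw [H, ← intervalIntegral.integral_Iic_sub_Iic hh.integrable.integrableOn
    hh.integrable.integrableOn, h1, sub_zero]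

lemma IsCostDensity.continuousOn_div (hh : IsCostDensity h) :
    ContinuousOn (fun t ↦ 1 / (1 - t) * h t) (Set.Ico 0 1) := by
  refine ContinuousOn.mul ?_ (hh.continuousOn.mono Set.Ico_subset_Icc_self)
  refine ContinuousOn.div continuousOn_const (by fun_prop) fun t ht ↦ ?_
  have := ht.2
  linarith

lemma IsCostDensity.intervalIntegrable_div (hh : IsCostDensity h) {y : ℝ} (h₀ : 0 ≤ y)
    (h₁ : y < 1) : IntervalIntegrable (fun t ↦ 1 / (1 - t) * h t) volume 0 y := by
  refine (hh.continuousOn_div.mono ?_).intervalIntegrable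
  rw [Set.uIcc_of_le h₀]
  exact fun t ht ↦ ⟨ht.1, ht.2.trans_lt h₁⟩

lemma hasDerivAt_integral_of_continuousOn {g : ℝ → ℝ} (hg : ContinuousOn g (Set.Ico 0 1)) {y : ℝ}
    (h₀ : 0 < y) (h₁ : y < 1) : HasDerivAt (fun u ↦ ∫ t in (0 : ℝ)..u, g t) (g y) y := by
  have hgo : ContinuousOn g (Set.Ioo 0 1) := hg.mono Set.Ioo_subset_Ico_self
  refine intervalIntegral.integral_hasDerivAt_right ?_
    (hgo.stronglyMeasurableAtFilter isOpen_Ioo y ⟨h₀, h₁⟩)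
    (hgo.continuousAt (Ioo_mem_nhds h₀ h₁))
  refine (hg.mono ?_).intervalIntegrable
  rw [Set.uIcc_of_le h₀.le]
  exact fun t ht ↦ ⟨ht.1, ht.2.trans_lt h₁⟩

/-- The open set of arguments in `(0, 1)` at which the cost function is defined. -/
def phiDomain (h : ℝ → ℝ) : Set ℝ := {x | 0 < x ∧ x < 1 ∧ 0 < H h (1 - x)}

/-- The derivative of the cost function on its domain. -/
noncomputable def phiDeriv (h : ℝ → ℝ) (x : ℝ) : ℝ :=
  (1 * (∫ t in (0 : ℝ)..(1 - x), h t) - x * (h (1 - x) * (-1))) /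
      (∫ t in (0 : ℝ)..(1 - x), h t) ^ 2 * (∫ t in (0 : ℝ)..(1 - x), 1 / (1 - t) * h t) +
    x / (∫ t in (0 : ℝ)..(1 - x), h t) * (1 / (1 - (1 - x)) * h (1 - x) * (-1))

lemma hasDerivAt_integral_one_sub {g : ℝ → ℝ} (hg : ContinuousOn g (Set.Ico 0 1)) {x : ℝ}
    (h₀ : 0 < x) (h₁ : x < 1) :
    HasDerivAt (fun u ↦ ∫ t in (0 : ℝ)..(1 - u), g t) (g (1 - x) * (-1)) x := by
  have h2 : HasDerivAt (fun u : ℝ ↦ 1 - u) (-1) x := by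
    simpa using (hasDerivAt_id x).const_sub 1
  exact (hasDerivAt_integral_of_continuousOn hg (by linarith : 0 < 1 - x) (by linarith)).comp x h2

lemma IsCostDensity.hasDerivAt_phi (hh : IsCostDensity h) {x : ℝ} (hx : x ∈ phiDomain h) :
    HasDerivAt (phi h) (phiDeriv h x) x := by
  obtain ⟨h₀, h₁, hH⟩ := hx
  rw [hh.H_eq] at hH
  have hA := hasDerivAt_integral_one_sub (hh.continuousOn.mono Set.Ico_subset_Icc_self) h₀ h₁
  have hB := hasDerivAt_integral_one_sub hh.continuousOn_div h₀ h₁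
  have hphi : phi h = fun x ↦ x / (∫ t in (0 : ℝ)..(1 - x), h t) *
      ∫ t in (0 : ℝ)..(1 - x), 1 / (1 - t) * h t := by
    ext x; rw [phi, hh.H_eq]
  rw [hphi]
  exact ((hasDerivAt_id x).div hA hH.ne').mul hB

lemma IsCostDensity.isOpen_phiDomain (hh : IsCostDensity h) : IsOpen (phiDomain h) := by
  have hcont : Continuous fun x ↦ H h (1 - x) := by
    simp only [hh.H_eq]
    exact (intervalIntegral.continuous_primitive (fun a b ↦ hh.integrable.intervalIntegrable)
      0).comp (continuous_const.sub continuous_id)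
  exact (isOpen_lt continuous_const continuous_id).inter
    ((isOpen_lt continuous_id continuous_const).inter (isOpen_lt continuous_const hcont))

lemma IsCostDensity.deriv_phi (hh : IsCostDensity h) {x : ℝ} (hx : x ∈ phiDomain h) :
    deriv (phi h) x = phiDeriv h x := (hh.hasDerivAt_phi hx).deriv

lemma IsCostDensity.continuousAt_phiDeriv (hh : IsCostDensity h) {x : ℝ} (hx : x ∈ phiDomain h) :
    ContinuousAt (phiDeriv h) x := by
  obtain ⟨h₀, h₁, hH⟩ := hx
  rw [hh.H_eq] at hH
  have hA := (hasDerivAt_integral_one_sub (hh.continuousOn.mono Set.Ico_subset_Icc_self)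
    h₀ h₁).continuousAt
  have hB := (hasDerivAt_integral_one_sub hh.continuousOn_div h₀ h₁).continuousAt
  have hc : ContinuousAt (fun u ↦ h (1 - u)) x := by
    have h1 : ContinuousAt h (1 - x) :=
      hh.continuousOn.continuousAt (Icc_mem_nhds (by linarith) (by linarith))
    exact ContinuousAt.comp (f := fun u : ℝ ↦ 1 - u) h1 (by fun_prop)
  have hid : ContinuousAt (fun u : ℝ ↦ u) x := continuousAt_id
  have hinv : ContinuousAt (fun u : ℝ ↦ 1 / (1 - (1 - u))) x :=
    ContinuousAt.div (by fun_prop) (by fun_prop) (by simpa using h₀.ne')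
  unfold phiDeriv
  refine ContinuousAt.add (ContinuousAt.mul (ContinuousAt.div ?_ (hA.pow 2) (by positivity)) hB)
    ((hid.div hA hH.ne').mul ((hinv.mul hc).mul continuousAt_const))
  exact (continuousAt_const.mul hA).sub (hid.mul (hc.mul continuousAt_const))

lemma IsCostDensity.continuousAt_deriv_phi (hh : IsCostDensity h) {x : ℝ}
    (hx : x ∈ phiDomain h) : ContinuousAt (deriv (phi h)) x := by
  refine (hh.continuousAt_phiDeriv hx).congr ?_
  filter_upwards [hh.isOpen_phiDomain.mem_nhds hx] with y hy
  exact (hh.deriv_phi hy).symm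

/-- Strict differentiability is needed because later both the true and the observed proportion vary
near `x`. -/
lemma IsCostDensity.hasStrictDerivAt_phi (hh : IsCostDensity h) {x : ℝ} (hx : x ∈ phiDomain h) :
    HasStrictDerivAt (phi h) (deriv (phi h) x) x := by
  rw [hh.deriv_phi hx]
  refine hasStrictDerivAt_of_hasDerivAt_of_continuousAt ?_ (hh.continuousAt_phiDeriv hx)
  filter_upwards [hh.isOpen_phiDomain.mem_nhds hx] with y hy
  exact hh.hasDerivAt_phi hy

/-- A density with positive mass on `[0, q]` has a positive integral against every positive
weight. -/
lemma IsCostDensity.integral_mul_pos (hh : IsCostDensity h) {q : ℝ} (hq : 0 ≤ q) {w : ℝ → ℝ}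
    (hw : ∀ t ∈ Set.Ioo 0 q, 0 < w t) (hint : IntervalIntegrable (fun t ↦ w t * h t) volume 0 q)
    (hpos : 0 < ∫ t in (0 : ℝ)..q, h t) : 0 < ∫ t in (0 : ℝ)..q, w t * h t := by
  rw [intervalIntegral.integral_of_le hq, integral_Ioc_eq_integral_Ioo] at hpos ⊢
  have hint' : IntegrableOn (fun t ↦ w t * h t) (Set.Ioo 0 q) :=
    ((intervalIntegrable_iff_integrableOn_Ioc_of_le hq).1 hint).mono_set Set.Ioo_subset_Ioc_self
  have hnn : 0 ≤ᵐ[volume.restrict (Set.Ioo 0 q)] fun t ↦ w t * h t := by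
    filter_upwards [ae_restrict_mem measurableSet_Ioo] with t ht
    exact mul_nonneg (hw t ht).le (hh.nonneg t)
  refine lt_of_le_of_ne (integral_nonneg_of_ae hnn) fun h0 ↦ hpos.ne' ?_
  rw [eq_comm, setIntegral_eq_zero_iff_of_nonneg_ae hnn hint'] at h0
  refine integral_eq_zero_of_ae ?_
  filter_upwards [h0, ae_restrict_mem measurableSet_Ioo] with t h1 ht
  exact (mul_eq_zero.1 h1).resolve_left (hw t ht).ne'

/-- Let `A` and `B` be the integrals of `h(t)` and `h(t)/(1 - t)` over `[0, 1 - p']`. Since `(π₀ -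
t)/(1 - t) = 1 - (1 - π₀)/(1 - t)`, the assumption reads `A = (1 - π₀) B`, whence `φ(p') = p' B / A
= p' / (1 - π₀) = p₀`. The weight `1/(1 - t)` lies strictly between `1` and `1/p'` inside the
interval, so `A < B < A / p'`, which is `p' < p₀ < 1`. -/
lemma IsCostDensity.params_spec (hh : IsCostDensity h) {θ : I × I} (hθ : θ ∈ Params h) :
    pPost θ ∈ phiDomain h ∧ phi h (pPost θ) = θ.1 ∧ pPost θ < θ.1 ∧ (θ.1 : ℝ) < 1 := by
  obtain ⟨h₀, hH, hcost⟩ := hθ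
  have h₁ : pPost θ < 1 := by
    refine lt_of_le_of_ne ((pPost_le θ).trans θ.1.2.2) fun h1 ↦ ?_
    rw [h1, hh.H_eq] at hH
    simp at hH
  have hdom : pPost θ ∈ phiDomain h := ⟨h₀, h₁, hH⟩
  have hphi : phi h (pPost θ) = pPost θ / H h (1 - pPost θ) *
    ∫ t in (0 : ℝ)..(1 - pPost θ), 1 / (1 - t) * h t := rfl
  rw [hh.H_eq] at hH hphi
  have hdef : pPost θ = θ.1 * (1 - θ.2) := rfl
  rw [CostAssumption] at hcost
  set p := pPost θ with hp
  set q := 1 - p with hq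
  have hq0 : 0 < q := by linarith
  have hq1 : q < 1 := by linarith
  have hiA : IntervalIntegrable h volume 0 q := hh.integrable.intervalIntegrable
  have hiB := hh.intervalIntegrable_div hq0.le hq1
  have hlin : ∀ r s : ℝ, ∫ t in (0 : ℝ)..q, (r - s / (1 - t)) * h t =
      r * (∫ t in (0 : ℝ)..q, h t) - s * ∫ t in (0 : ℝ)..q, 1 / (1 - t) * h t := by
    intro r s
    rw [← intervalIntegral.integral_const_mul, ← intervalIntegral.integral_const_mul,
      ← intervalIntegral.integral_sub (hiA.const_mul r) (hiB.const_mul s)]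
    congr 1
    ext t
    ring
  have hli : ∀ r s : ℝ, IntervalIntegrable (fun t ↦ (r - s / (1 - t)) * h t) volume 0 q := by
    intro r s
    refine ((hiA.const_mul r).sub (hiB.const_mul s)).congr fun t _ ↦ ?_
    ring
  have hne : ∀ t ∈ Set.Ioo 0 q, 0 < 1 - t := fun t ht ↦ by have := ht.2; linarith
  set A := ∫ t in (0 : ℝ)..q, h t with hA
  set B := ∫ t in (0 : ℝ)..q, 1 / (1 - t) * h t with hB
  have hAB : A = (1 - θ.2) * B := by
    have h1 : ∫ t in (0 : ℝ)..q, ((θ.2 : ℝ) - t) / (1 - t) * h t =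
        ∫ t in (0 : ℝ)..q, (1 - (1 - (θ.2 : ℝ)) / (1 - t)) * h t := by
      refine intervalIntegral.integral_congr fun t ht ↦ ?_
      rw [Set.uIcc_of_le hq0.le] at ht
      have : 1 - t ≠ 0 := by have := ht.2; linarith
      congr 1
      field_simp
      ring
    rw [h1, hlin, one_mul] at hcost
    linarith
  have hAltB : A < B := by
    have := hh.integral_mul_pos hq0.le (w := fun t ↦ -1 - (-1) / (1 - t)) (fun t ht ↦ by
      have h1 := hne t ht
      have : -1 - (-1) / (1 - t) = t / (1 - t) := by field_simp; ring
      rw [this]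
      exact div_pos ht.1 h1) (hli _ _) hH
    rw [hlin] at this
    linarith
  have hpB : p * B < A := by
    have := hh.integral_mul_pos hq0.le (w := fun t ↦ 1 - p / (1 - t)) (fun t ht ↦ by
      have h1 := hne t ht
      rw [sub_pos, div_lt_one h1]
      have := ht.2
      linarith) (hli _ _) hH
    rw [hlin] at this
    linarith
  have hπ : 0 < 1 - (θ.2 : ℝ) := by
    refine lt_of_le_of_ne (sub_nonneg.2 θ.2.2.2) fun h0 ↦ ?_
    rw [← h0, mul_zero] at hdef
    linarith
  have hB0 : 0 < B := hH.trans hAltB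
  have hval : phi h p = θ.1 := by
    rw [hphi, hAB, hdef]
    field_simp
  refine ⟨hdom, hval, ?_, ?_⟩
  · rw [← hval, hphi, div_mul_eq_mul_div, lt_div_iff₀ hH]
    exact mul_lt_mul_of_pos_left hAltB h₀
  · rw [← hval, hphi, div_mul_eq_mul_div, div_lt_one hH]
    exact hpB

/-! ### Coverage of the interval -/

/-- Here `q.1` stands for the true and `q.2` for the observed proportion. The last two inequalities
hold with factor 1 in the limit, by continuity of `voteSd` and of `φ'` and because `φ` has slope
`φ'(x₀)` to first order; `r < 1` turns this into a bound on a neighbourhood. -/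
lemma IsCostDensity.eventually_nhds_local_bound (hh : IsCostDensity h) {r : ℝ}
    (hr₁ : r < 1) {x₀ : ℝ} (hx₀ : x₀ ∈ phiDomain h) (hd : deriv (phi h) x₀ ≠ 0) :
    ∀ᶠ q : ℝ × ℝ in 𝓝 (x₀, x₀),
      deriv (phi h) q.2 ≠ 0 ∧ 0 < voteSd q.2 ∧ r * voteSd q.1 < voteSd q.2 ∧
      r * voteSd q.1 * |phi h q.1 - phi h q.2| ≤
        |deriv (phi h) q.2| * voteSd q.2 * |q.1 - q.2| := by
  have hsdc : Continuous voteSd := by unfold voteSd; fun_prop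
  have hsd : 0 < voteSd x₀ := Real.sqrt_pos.2 (mul_pos hx₀.1 (by linarith [hx₀.2.1]))
  set A := |deriv (phi h) x₀| with hA
  have hA0 : 0 < A := abs_pos.2 hd
  have hsnd : Tendsto (fun q : ℝ × ℝ ↦ q.2) (𝓝 (x₀, x₀)) (𝓝 x₀) := continuous_snd.tendsto _
  have hderiv : Tendsto (fun q : ℝ × ℝ ↦ |deriv (phi h) q.2|) (𝓝 (x₀, x₀)) (𝓝 A) :=
    ((hh.continuousAt_deriv_phi hx₀).tendsto.comp hsnd).abs
  have hs1 : Tendsto (fun q : ℝ × ℝ ↦ r * voteSd q.1) (𝓝 (x₀, x₀)) (𝓝 (r * voteSd x₀)) :=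
    ((hsdc.comp continuous_fst).tendsto (x₀, x₀)).const_mul r
  have hs2 : Tendsto (fun q : ℝ × ℝ ↦ voteSd q.2) (𝓝 (x₀, x₀)) (𝓝 (voteSd x₀)) :=
    (hsdc.comp continuous_snd).tendsto (x₀, x₀)
  have e1 : ∀ᶠ q : ℝ × ℝ in 𝓝 (x₀, x₀), 0 < |deriv (phi h) q.2| := hderiv.eventually_const_lt hA0
  have e2 : ∀ᶠ q : ℝ × ℝ in 𝓝 (x₀, x₀), 0 < voteSd q.2 := hs2.eventually_const_lt hsd
  have e3 : ∀ᶠ q : ℝ × ℝ in 𝓝 (x₀, x₀), r * voteSd q.1 < voteSd q.2 :=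
    hs1.eventually_lt hs2 (by nlinarith)
  obtain ⟨ε, hε, hε'⟩ : ∃ ε : ℝ, 0 < ε ∧ r * voteSd x₀ * (A + ε) < A * voteSd x₀ := by
    have hcont : Tendsto (fun ε : ℝ ↦ r * voteSd x₀ * (A + ε)) (𝓝[>] 0)
        (𝓝 (r * voteSd x₀ * (A + 0))) :=
      (Continuous.tendsto (by fun_prop) 0).mono_left nhdsWithin_le_nhds
    have hlt : r * voteSd x₀ * (A + 0) < A * voteSd x₀ := by
      have := mul_pos hA0 hsd
      nlinarith
    obtain ⟨ε, h1, h2⟩ := ((hcont.eventually_lt_const hlt).and self_mem_nhdsWithin).exists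
    exact ⟨ε, h2, h1⟩
  have e4 : ∀ᶠ q : ℝ × ℝ in 𝓝 (x₀, x₀), r * voteSd q.1 * (A + ε) <
      |deriv (phi h) q.2| * voteSd q.2 := (hs1.mul_const _).eventually_lt (hderiv.mul hs2) hε'
  have e5 : ∀ᶠ q : ℝ × ℝ in 𝓝 (x₀, x₀), |phi h q.1 - phi h q.2| ≤ (A + ε) * |q.1 - q.2| := by
    have := (hh.hasStrictDerivAt_phi hx₀).isLittleO.def hε
    filter_upwards [this] with q hq
    simp only [ContinuousLinearMap.toSpanSingleton_apply, smul_eq_mul, Real.norm_eq_abs] at hq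
    have h1 : |phi h q.1 - phi h q.2| ≤ |phi h q.1 - phi h q.2 - (q.1 - q.2) * deriv (phi h) x₀| +
        |(q.1 - q.2) * deriv (phi h) x₀| := by
      simpa using abs_add_le (phi h q.1 - phi h q.2 - (q.1 - q.2) * deriv (phi h) x₀)
        ((q.1 - q.2) * deriv (phi h) x₀)
    rw [abs_mul] at h1
    linarith
  by_cases hr : 0 ≤ r
  · filter_upwards [e1, e2, e3, e4, e5] with q h1 h2 h3 h4 h5
    refine ⟨abs_pos.1 h1, h2, h3, ?_⟩
    have h6 : 0 ≤ voteSd q.1 := Real.sqrt_nonneg _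
    calc r * voteSd q.1 * |phi h q.1 - phi h q.2|
        ≤ r * voteSd q.1 * ((A + ε) * |q.1 - q.2|) := by gcongr
      _ = r * voteSd q.1 * (A + ε) * |q.1 - q.2| := by ring
      _ ≤ _ := by gcongr
  · filter_upwards [e1, e2, e3] with q h1 h2 h3
    refine ⟨abs_pos.1 h1, h2, h3, ?_⟩
    have h6 : 0 ≤ voteSd q.1 := Real.sqrt_nonneg _
    refine le_trans ?_ (by positivity : 0 ≤ |deriv (phi h) q.2| * voteSd q.2 * |q.1 - q.2|)
    exact mul_nonpos_of_nonpos_of_nonneg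
      (mul_nonpos_of_nonpos_of_nonneg (not_le.1 hr).le h6) (abs_nonneg _)

/-- An observed proportion that deviates from its mean by slightly less than the half-width of the
confidence interval puts the parameters into `S₁` and `S₂`, uniformly on compact sets. -/
lemma IsCostDensity.eventually_mem_S1_S2 (hh : IsCostDensity h) {z r : ℝ} (hz : 0 < z)
    (hr₀ : 0 < r) (hr₁ : r < 1) {L : Set ℝ} (hL : IsCompact L)
    (hLd : ∀ x ∈ L, x ∈ phiDomain h ∧ deriv (phi h) x ≠ 0) :
    ∀ᶠ n : ℕ in atTop, ∀ x ∈ L, ∀ y : ℝ, |y - x| < r * z * voteSd x / √n →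
      x ∈ S1 z n y ∧ phi h x ∈ S2 h z n y := by
  let good : ℝ × ℝ → Prop := fun q ↦
      deriv (phi h) q.2 ≠ 0 ∧ 0 < voteSd q.2 ∧ r * voteSd q.1 < voteSd q.2 ∧
      r * voteSd q.1 * |phi h q.1 - phi h q.2| ≤
        |deriv (phi h) q.2| * voteSd q.2 * |q.1 - q.2|
  -- The bound holds on squares `V × V` around the diagonal; a Lebesgue number of the cover by the
  -- sets `V` gives one distance that works for all of `L`.
  have hloc : ∀ x : L, ∃ V : Set ℝ, IsOpen V ∧ (x : ℝ) ∈ V ∧ ∀ a ∈ V, ∀ b ∈ V, good (a, b) := by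
    intro x
    have := hh.eventually_nhds_local_bound hr₁ (hLd x x.2).1 (hLd x x.2).2
    rw [nhds_prod_eq] at this
    obtain ⟨t, ht, hgood⟩ := (eventually_prod_self_iff (r := fun a b ↦ good (a, b))).1 this
    obtain ⟨V, hVt, hV, hxV⟩ := mem_nhds_iff.1 ht
    exact ⟨V, hV, hxV, fun a ha b hb ↦ hgood a (hVt ha) b (hVt hb)⟩
  choose V hV hxV hgood using hloc
  obtain ⟨δ, hδ, hleb⟩ := lebesgue_number_lemma_of_metric hL hV
    (fun x hx ↦ Set.mem_iUnion.2 ⟨⟨x, hx⟩, hxV ⟨x, hx⟩⟩)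
  have hsq : Tendsto (fun n : ℕ ↦ √(n : ℝ)) atTop atTop :=
    Real.tendsto_sqrt_atTop.comp tendsto_natCast_atTop_atTop
  filter_upwards [hsq.eventually_gt_atTop (z / δ), eventually_ge_atTop 1] with n hn hn1 x hx y hy
  have hs : 0 < √(n : ℝ) := Real.sqrt_pos.2 (by exact_mod_cast hn1)
  obtain ⟨h₀, h₁, -⟩ := (hLd x hx).1
  have hsx : 0 < voteSd x := Real.sqrt_pos.2 (mul_pos h₀ (by linarith))
  have hsx1 : voteSd x ≤ 1 := Real.sqrt_le_one.2 (by nlinarith)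
  have hzd : z / √n < δ := by
    rw [div_lt_iff₀ hδ] at hn
    rw [div_lt_iff₀ hs]
    linarith
  have hyx : |y - x| < δ := by
    refine hy.trans (lt_of_le_of_lt ?_ hzd)
    gcongr
    have : r * voteSd x ≤ 1 := by nlinarith
    nlinarith
  obtain ⟨i, hi⟩ := hleb x hx
  obtain ⟨g1, g2, g3, g4⟩ : good (x, y) := hgood i x (hi (Metric.mem_ball_self hδ)) y
    (hi (by rwa [Metric.mem_ball, Real.dist_eq]))
  simp only at g1 g2 g3 g4
  have hgam : gam z n y = voteSd y * z / √n := rfl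
  have hgpos : 0 < gam z n y := by rw [hgam]; positivity
  have hd : 0 < |deriv (phi h) y| := abs_pos.2 g1
  have hxy : |x - y| < r * z * voteSd x / √n := by rwa [abs_sub_comm]
  have hw : |x - y| < gam z n y := by
    refine hxy.trans ?_
    rw [hgam]
    gcongr ?_ / _
    nlinarith
  have hw2 : |phi h x - phi h y| < |deriv (phi h) y| * gam z n y := by
    have hlt : r * voteSd x * |phi h x - phi h y| <
        r * voteSd x * (|deriv (phi h) y| * gam z n y) := by
      calc r * voteSd x * |phi h x - phi h y| ≤ |deriv (phi h) y| * voteSd y * |x - y| := g4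
        _ < |deriv (phi h) y| * voteSd y * (r * z * voteSd x / √n) := by gcongr
        _ = r * voteSd x * (|deriv (phi h) y| * gam z n y) := by rw [hgam]; ring
    exact lt_of_mul_lt_mul_left hlt (by positivity)
  rw [abs_lt] at hw hw2
  exact ⟨⟨by linarith, by linarith⟩, ⟨by linarith, by linarith⟩⟩

lemma bddAbove_etaValues (z : ℝ) (n : ℕ) (p : ℝ) : BddAbove (etaValues h z n p) :=
  ⟨1, by rintro _ ⟨p₀, p', -, -, -, -, -, rfl⟩; exact eta_le_one _ _ _⟩

lemma bddBelow_etaValues (z : ℝ) (n : ℕ) (p : ℝ) : BddBelow (etaValues h z n p) :=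
  ⟨0, by rintro _ ⟨p₀, p', -, -, -, -, -, rfl⟩; exact eta_nonneg _ _ _⟩

/-- The interval contains `η(p₀, p', n)` in its interior as soon as `p' ∈ S₁` and `p₀ ∈ S₂`. -/
lemma eta_mem_Ioo {z p p₀ p' : ℝ} {n : ℕ} (hn : 1 ≤ n) (h₀ : 0 < p') (h₁ : p' < p₀) (h₂ : p₀ < 1)
    (hS1 : p' ∈ S1 z n p) (hS2 : p₀ ∈ S2 h z n p) :
    eta p₀ p' n ∈ Set.Ioo (lowerEnd h z n p) (upperEnd h z n p) := by
  -- Keep `p₀` fixed and move `p'` slightly to either side within `S₁`: strict monotonicity puts `η`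
  -- strictly between two attained values.
  obtain ⟨l, hl, hl'⟩ : ∃ l, max 0 (p - gam z n p) < l ∧ l < p' :=
    exists_between (max_lt h₀ hS1.1)
  obtain ⟨u, hu, hu'⟩ : ∃ u, p' < u ∧ u < min p₀ (p + gam z n p) :=
    exists_between (lt_min h₁ hS1.2)
  rw [max_lt_iff] at hl
  rw [lt_min_iff] at hu'
  constructor
  · refine (csInf_le (bddBelow_etaValues z n p) ⟨p₀, l, ⟨hl.2, hl'.trans hS1.2⟩, hS2, hl.1.le,
      by linarith, h₂.le, rfl⟩).trans_lt ?_
    exact eta_strictMono_right hn hl.1 hl' h₁ h₂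
  · refine lt_of_lt_of_le ?_ (le_csSup (bddAbove_etaValues z n p) ⟨p₀, u,
      ⟨hS1.1.trans hu, hu'.2⟩, hS2, by linarith, hu'.1.le, h₂.le, rfl⟩)
    exact eta_strictMono_right hn h₀ hu hu'.1 h₂

/-! ### Normal quantiles -/

lemma gaussianReal_Ioo_neg {z β : ℝ} (hz : (gaussianReal 0 1).real (Set.Ioi z) = β / 2)
    (hz0 : 0 < z) : (gaussianReal 0 1).real (Set.Ioo (-z) z) = 1 - β := by
  have : NullSingletonClass (gaussianReal 0 1) := nullSingletonClass_gaussianReal (by simp)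
  have hneg : (gaussianReal 0 1).real (Set.Iic (-z)) = β / 2 := by
    have h1 : (gaussianReal 0 1).real (Set.Iio (-z)) = (gaussianReal 0 1).real (Set.Ioi z) := by
      have h2 : gaussianReal 0 1 = (gaussianReal 0 1).map (fun x ↦ -x) := by
        rw [gaussianReal_map_neg, neg_zero]
      conv_lhs => rw [h2, map_measureReal_apply measurable_neg measurableSet_Iio]
      congr 1
      ext x
      simp
    rw [← hz, ← h1]
    exact (measureReal_congr Iio_ae_eq_Iic).symm
  have hpos : (gaussianReal 0 1).real (Set.Ici z) = β / 2 := by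
    rw [← hz]
    exact (measureReal_congr Ioi_ae_eq_Ici).symm
  have hcompl : Set.Ioo (-z) z = (Set.Iic (-z) ∪ Set.Ici z)ᶜ := by
    ext x; simp
  rw [hcompl, probReal_compl_eq_one_sub (measurableSet_Iic.union measurableSet_Ici),
    measureReal_union (Set.disjoint_left.2 fun x hx hx' ↦ by
      rw [Set.mem_Iic] at hx; rw [Set.mem_Ici] at hx'; linarith) measurableSet_Ici, hneg, hpos]
  ring

/-- A nonpositive `z` would have an upper tail of at least `1/2 > β/2`. -/
lemma quantile_pos {z β : ℝ} (hβ₁ : β < 1)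
    (hz : (gaussianReal 0 1).real (Set.Ioi z) = β / 2) : 0 < z := by
  by_contra hz0
  have : NullSingletonClass (gaussianReal 0 1) := nullSingletonClass_gaussianReal (by simp)
  have h1 : (gaussianReal 0 1).real (Set.Iio 0) = (gaussianReal 0 1).real (Set.Ioi 0) := by
    have h2 : gaussianReal 0 1 = (gaussianReal 0 1).map (fun x ↦ -x) := by
      rw [gaussianReal_map_neg, neg_zero]
    conv_lhs => rw [h2, map_measureReal_apply measurable_neg measurableSet_Iio]
    congr 1
    ext x
    simp
  have h2 : (gaussianReal 0 1).real (Set.Iic 0) = (gaussianReal 0 1).real (Set.Iio 0) :=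
    (measureReal_congr Iio_ae_eq_Iic).symm
  have h3 : (gaussianReal 0 1).real (Set.Ioi 0) = 1 - (gaussianReal 0 1).real (Set.Iic 0) := by
    rw [← probReal_compl_eq_one_sub measurableSet_Iic, Set.compl_Iic]
  have h4 : (gaussianReal 0 1).real (Set.Ioi 0) ≤ (gaussianReal 0 1).real (Set.Ioi z) :=
    measureReal_mono (Set.Ioi_subset_Ioi (not_lt.1 hz0))
  linarith

/-- A slightly shorter symmetric interval still has more than a given probability. -/
lemma exists_shrink_gaussianReal_Ioo {z c : ℝ} (hz : 0 < z)
    (hc : c < (gaussianReal 0 1).real (Set.Ioo (-z) z)) :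
    ∃ r, 0 < r ∧ r < 1 ∧ c < (gaussianReal 0 1).real (Set.Ioo (-(r * z)) (r * z)) := by
  -- Any sequence in `(0, 1)` increasing to 1 would do: the open intervals then increase to `(-z,
  -- z)`, and continuity from below applies.
  let r : ℕ → ℝ := fun k ↦ 1 - 1 / ((k : ℝ) + 2)
  have hr : Tendsto r atTop (𝓝 1) := by
    have : Tendsto (fun k : ℕ ↦ 1 / ((k : ℝ) + 2)) atTop (𝓝 0) :=
      tendsto_const_nhds.div_atTop (tendsto_atTop_add_const_right _ _ tendsto_natCast_atTop_atTop)
    simpa [r] using this.const_sub 1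
  have hmono : Monotone fun k ↦ Set.Ioo (-(r k * z)) (r k * z) := by
    intro i j hij
    have : r i ≤ r j := by simp only [r]; gcongr
    have : r i * z ≤ r j * z := by gcongr
    exact Set.Ioo_subset_Ioo (by linarith) this
  have hr1 : ∀ k, r k < 1 := fun k ↦ by
    have : 0 < 1 / ((k : ℝ) + 2) := by positivity
    simp only [r]; linarith
  have hunion : ⋃ k, Set.Ioo (-(r k * z)) (r k * z) = Set.Ioo (-z) z := by
    ext x
    simp only [Set.mem_iUnion, ← abs_lt, Set.mem_Ioo]
    constructor
    · rintro ⟨k, hk⟩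
      exact hk.trans (by nlinarith [hr1 k])
    · intro hx
      have : Tendsto (fun k ↦ r k * z) atTop (𝓝 (1 * z)) := hr.mul_const z
      exact (this.eventually_const_lt (by linarith : |x| < 1 * z)).exists
  have ht := tendsto_measure_iUnion_atTop (μ := gaussianReal 0 1) hmono
  rw [hunion] at ht
  have ht' := (ENNReal.tendsto_toReal (measure_ne_top _ _)).comp ht
  obtain ⟨k, hk⟩ := (ht'.eventually_const_lt hc).exists
  refine ⟨r k, ?_, hr1 k, hk⟩
  have : 1 / ((k : ℝ) + 2) < 1 := by
    rw [div_lt_one (by positivity)]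
    have : (0 : ℝ) ≤ k := by positivity
    linarith
  simp only [r]; linarith

/-- The central limit theorem, uniformly on compact sets of parameters. -/
lemma eventually_forall_lt_electionLaw {a b : ℝ} (hab₁ : a ^ 2 + 1 < a * b)
    (hab₂ : a * b ≤ b ^ 2 + 1) {K : Set (I × I)} (hK : IsCompact K)
    (hK01 : ∀ θ ∈ K, 0 < pPost θ ∧ pPost θ < 1) {c t : ℝ}
    (hc : c < (gaussianReal 0 1).real (Set.Ioo (-t) t)) :
    ∀ᶠ n : ℕ in atTop, ∀ θ ∈ K, c < (electionLaw θ n).real {ω | |stdProp a b θ n ω| < t} := by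
  rcases K.eq_empty_or_nonempty with rfl | hne
  · simp
  have hcont : Continuous fun θ ↦ voteSd (pPost θ) := by
    have := continuous_pPost
    unfold voteSd; fun_prop
  obtain ⟨θm, hθm, hmin⟩ := hK.exists_isMinOn hne hcont.continuousOn
  have hspos : 0 < voteSd (pPost θm) :=
    Real.sqrt_pos.2 (mul_pos (hK01 _ hθm).1 (by linarith [(hK01 _ hθm).2]))
  -- For each `n` choose a parameter that violates the bound if any does. The limit theorem along
  -- this sequence shows that for large `n` none does.
  have hbad : ∀ n : ℕ, ∃ θ ∈ K, (c < (electionLaw θ n).real {ω | |stdProp a b θ n ω| < t}) →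
      ∀ θ' ∈ K, c < (electionLaw θ' n).real {ω | |stdProp a b θ' n ω| < t} := by
    intro n
    by_cases hall : ∀ θ' ∈ K, c < (electionLaw θ' n).real {ω | |stdProp a b θ' n ω| < t}
    · exact ⟨θm, hθm, fun _ ↦ hall⟩
    · push Not at hall
      obtain ⟨θ, hθ, hle⟩ := hall
      exact ⟨θ, hθ, fun hlt ↦ absurd hlt (not_lt.2 hle)⟩
  choose θ hθ himp using hbad
  have ht := tendsto_electionLaw_abs_stdProp_lt hab₁ hab₂ hspos θ (fun n ↦
    ⟨(hK01 _ (hθ n)).1, (hK01 _ (hθ n)).2, hmin (hθ n)⟩) t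
  filter_upwards [ht.eventually_const_lt hc] with n hn
  exact himp n hn

lemma abs_observedProp_sub_lt {a b t : ℝ} {θ : I × I} {n : ℕ} (hn : 1 ≤ n)
    (hs : 0 < voteSd (pPost θ)) {ω : Fin n → Bool × Bool} (hω : |stdProp a b θ n ω| < t) :
    |observedProp a b n ω - pPost θ| < t * voteSd (pPost θ) / √n := by
  have hr : 0 < √(n : ℝ) := Real.sqrt_pos.2 (by exact_mod_cast hn)
  rw [stdProp, abs_div, abs_mul, abs_of_pos hr, abs_of_pos hs, div_lt_iff₀ hs] at hω
  rw [lt_div_iff₀ hr]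
  linarith

/-- Uniform coverage of the interval. -/
lemma IsCostDensity.eventually_coverage (hh : IsCostDensity h) {a b : ℝ}
    (hab₁ : a ^ 2 + 1 < a * b) (hab₂ : a * b ≤ b ^ 2 + 1) {z c : ℝ} (hz : 0 < z)
    (hc : c < (gaussianReal 0 1).real (Set.Ioo (-z) z)) {K : Set (I × I)} (hK : IsCompact K)
    (hKp : ∀ θ ∈ K, θ ∈ Params h ∧ deriv (phi h) (pPost θ) ≠ 0) :
    ∀ᶠ n : ℕ in atTop, ∀ θ ∈ K, c ≤ (electionLaw θ n).real
      {ω | eta θ.1 (pPost θ) n ∈ Set.Ioo (lowerEnd h z n (observedProp a b n ω))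
        (upperEnd h z n (observedProp a b n ω))} := by
  obtain ⟨r, hr₀, hr₁, hrc⟩ := exists_shrink_gaussianReal_Ioo hz hc
  have hspec : ∀ θ ∈ K, _ := fun θ hθ ↦ hh.params_spec (hKp θ hθ).1
  have hclt := eventually_forall_lt_electionLaw hab₁ hab₂ hK
    (fun θ hθ ↦ ⟨(hspec θ hθ).1.1, (hspec θ hθ).1.2.1⟩) hrc
  have hmem := hh.eventually_mem_S1_S2 hz hr₀ hr₁ (hK.image continuous_pPost) (by
    rintro _ ⟨θ, hθ, rfl⟩
    exact ⟨(hspec θ hθ).1, (hKp θ hθ).2⟩)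
  filter_upwards [hclt, hmem, eventually_ge_atTop 1] with n h1 h2 hn θ hθ
  refine (h1 θ hθ).le.trans (measureReal_mono fun ω hω ↦ ?_)
  obtain ⟨hdom, hphi, hlt, hlt1⟩ := hspec θ hθ
  have hs : 0 < voteSd (pPost θ) :=
    Real.sqrt_pos.2 (mul_pos hdom.1 (by linarith [hdom.2.1]))
  obtain ⟨hS1, hS2⟩ := h2 _ ⟨θ, hθ, rfl⟩ (observedProp a b n ω)
    (abs_observedProp_sub_lt hn hs hω)
  rw [hphi] at hS2
  exact eta_mem_Ioo hn hdom.1 hlt hlt1 hS1 hS2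

/-- The level of the test follows from the coverage of the interval. -/
lemma electionLaw_upperEnd_lt_le {a b z α τ : ℝ} {θ : I × I} {n : ℕ}
    (hcov : 1 - α ≤ (electionLaw θ n).real
      {ω | eta θ.1 (pPost θ) n ∈ Set.Ioo (lowerEnd h z n (observedProp a b n ω))
        (upperEnd h z n (observedProp a b n ω))})
    (hτ : τ ≤ eta θ.1 (pPost θ) n) :
    (electionLaw θ n).real {ω | upperEnd h z n (observedProp a b n ω) < τ} ≤ α := by
  set C := {ω | eta θ.1 (pPost θ) n ∈ Set.Ioo (lowerEnd h z n (observedProp a b n ω))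
        (upperEnd h z n (observedProp a b n ω))} with hC
  have hsub : {ω | upperEnd h z n (observedProp a b n ω) < τ} ⊆ Cᶜ := by
    intro ω hω hωC
    have h1 : eta θ.1 (pPost θ) n < upperEnd h z n (observedProp a b n ω) := hωC.2
    have h2 : upperEnd h z n (observedProp a b n ω) < τ := hω
    linarith
  have h1 := measureReal_mono (μ := electionLaw θ n) hsub
  rw [probReal_compl_eq_one_sub (MeasurableSet.of_discrete)] at h1
  linarith

/-! ### Consistency of the test -/

lemma tendsto_two_div_natCast_mul (d : ℝ) :
    Tendsto (fun n : ℕ ↦ 2 / (n * d ^ 2)) atTop (𝓝 0) := by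
  have : Tendsto (fun n : ℕ ↦ 2 / d ^ 2 / (n : ℝ)) atTop (𝓝 0) :=
    tendsto_const_div_atTop_nhds_zero_nat _
  refine this.congr fun n ↦ ?_
  rw [div_div, mul_comm]

lemma tendsto_eta_of_opposite {p₀ p' : ℝ} (h₀ : 0 ≤ p') (h₂ : p₀ ≤ 1) (hp₀ : 0 < 2 * p₀ - 1)
    (hp' : 2 * p' - 1 < 0) : Tendsto (fun n ↦ eta p₀ p' n) atTop (𝓝 0) := by
  set d := min (2 * p₀ - 1) (1 - 2 * p') with hd
  have hd0 : 0 < d := lt_min hp₀ (by linarith)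
  have h1 : d ≤ 2 * p₀ - 1 := min_le_left _ _
  have h2 : d ≤ 1 - 2 * p' := min_le_right _ _
  refine tendsto_of_tendsto_of_tendsto_of_le_of_le' tendsto_const_nhds
    (tendsto_two_div_natCast_mul d) (.of_forall fun n ↦ eta_nonneg _ _ _) ?_
  filter_upwards [eventually_ge_atTop 1] with n hn
  exact eta_le_of_opposite hn h₀ h₂ hd0 h1 (by linarith)

/-- If the parameters are on different sides of the majority threshold, then the upper end of the
interval is small for all observed proportions close to `p'`. -/
lemma IsCostDensity.exists_upperEnd_le (hh : IsCostDensity h) {z : ℝ} (hz : 0 < z) {x : ℝ}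
    (hx : x ∈ phiDomain h) (hphi : 0 < 2 * phi h x - 1) (hx' : 2 * x - 1 < 0) {ε : ℝ}
    (hε : 0 < ε) :
    ∃ δ > 0, ∀ᶠ n : ℕ in atTop, ∀ y, |y - x| < δ → upperEnd h z n y ≤ ε := by
  -- Half of the margin. Moving from `x` to `y` and the half-width of an interval cost `d / 4` each,
  -- hence `d` in total in `2 q - 1`, and a margin `d` remains.
  set d := min (2 * phi h x - 1) (1 - 2 * x) / 2 with hd
  have hd0 : 0 < d := half_pos (lt_min hphi (by linarith))
  have hd1 : 2 * d ≤ 2 * phi h x - 1 := by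
    have := min_le_left (2 * phi h x - 1) (1 - 2 * x)
    linarith
  have hd2 : 2 * d ≤ 1 - 2 * x := by
    have := min_le_right (2 * phi h x - 1) (1 - 2 * x)
    linarith
  set C := |deriv (phi h) x| + 1 with hC
  have hC1 : 1 ≤ C := by have := abs_nonneg (deriv (phi h) x); linarith
  have e1 : ∀ᶠ y in 𝓝 x, |deriv (phi h) y| < C :=
    (hh.continuousAt_deriv_phi hx).abs.eventually_lt_const (by linarith)
  have e2 : ∀ᶠ y in 𝓝 x, phi h x - d / 4 < phi h y :=
    (hh.hasDerivAt_phi hx).continuousAt.eventually_const_lt (by linarith)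
  have e3 : ∀ᶠ y in 𝓝 x, y < x + d / 4 := eventually_lt_nhds (by linarith)
  obtain ⟨δ, hδ, hball⟩ := Metric.eventually_nhds_iff.1 (e1.and (e2.and e3))
  refine ⟨δ, hδ, ?_⟩
  have hsq : Tendsto (fun n : ℕ ↦ √(n : ℝ)) atTop atTop :=
    Real.tendsto_sqrt_atTop.comp tendsto_natCast_atTop_atTop
  filter_upwards [hsq.eventually_gt_atTop (4 * C * z / d), eventually_ge_atTop 1,
    (tendsto_two_div_natCast_mul d).eventually_lt_const hε] with n hn hn1 hne y hy
  obtain ⟨h1, h2, h3⟩ := hball (by rwa [Real.dist_eq])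
  have hs : 0 < √(n : ℝ) := Real.sqrt_pos.2 (by exact_mod_cast hn1)
  have hg0 : 0 ≤ gam z n y := by unfold gam; positivity
  have hsd : √(y * (1 - y)) ≤ 1 := Real.sqrt_le_one.2 (by nlinarith [sq_nonneg (2 * y - 1)])
  have hCg : C * gam z n y ≤ d / 4 := by
    rw [div_lt_iff₀ hd0] at hn
    unfold gam
    rw [mul_div_assoc', div_le_iff₀ hs]
    have : C * (√(y * (1 - y)) * z) ≤ C * (1 * z) := by gcongr
    linarith
  have hg : gam z n y ≤ d / 4 := by nlinarith
  have hg' : |deriv (phi h) y| * gam z n y ≤ d / 4 :=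
    (mul_le_mul_of_nonneg_right h1.le hg0).trans hCg
  -- This also covers an empty set of values, where the upper end is `0`; so `φ' ≠ 0` is not needed
  -- for consistency.
  refine Real.sSup_le ?_ hε.le
  rintro _ ⟨q₀, q', hq', hq₀, hq'0, -, hq₀1, rfl⟩
  refine (eta_le_of_opposite hn1 hq'0 hq₀1 hd0 ?_ ?_).trans hne.le
  · have := hq₀.1
    linarith
  · have := hq'.2
    linarith

lemma tendsto_electionLaw_abs_sub_lt {a b : ℝ} (hab₁ : a ^ 2 + 1 < a * b)
    (hab₂ : a * b ≤ b ^ 2 + 1) (θ : I × I) {δ : ℝ} (hδ : 0 < δ) :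
    Tendsto (fun n ↦ (electionLaw θ n).real {ω | |observedProp a b n ω - pPost θ| < δ}) atTop
      (𝓝 1) := by
  have h1 : Tendsto (fun n : ℕ ↦ 1 - 2 / (n * δ ^ 2)) atTop (𝓝 1) := by
    simpa using (tendsto_two_div_natCast_mul δ).const_sub 1
  refine tendsto_of_tendsto_of_tendsto_of_le_of_le' h1 tendsto_const_nhds ?_
    (.of_forall fun n ↦ measureReal_le_one)
  filter_upwards [eventually_ge_atTop 1] with n hn
  have h2 := observedProp_chebyshev hab₁ hab₂ θ hn hδ
  have h3 : {ω : Fin n → Bool × Bool | |observedProp a b n ω - pPost θ| < δ} =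
      {ω | δ ≤ |observedProp a b n ω - pPost θ|}ᶜ := by
    ext ω; simp
  rw [h3, probReal_compl_eq_one_sub MeasurableSet.of_discrete]
  have h4 : 1 / (n * δ ^ 2) ≤ 2 / (n * δ ^ 2) := by gcongr; norm_num
  linarith

end VoterModel

theorem theorem1
    -- the cost density `h`
    (h : ℝ → ℝ) (hh : VoterModel.IsCostDensity h)
    -- an intervention `v = (a, b)` that turns supporters of the first candidate only
    (a b : ℝ) (ha : 0 < a) (hb : 0 < b) (hab₁ : a ^ 2 + 1 < a * b) (hab₂ : a * b ≤ b ^ 2 + 1)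
    -- `(1 - β)² = 1 - α`, and `z` is the upper `β / 2` quantile of the standard normal law
    (α β z : ℝ) (hα₀ : 0 < α) (hα₁ : α < 1) (hβ₀ : 0 < β) (hβ₁ : β < 1)
    (hβ : (1 - β) ^ 2 = 1 - α) (hz : (gaussianReal 0 1).real (Set.Ioi z) = β / 2)
    -- the critical value
    (τ : ℝ) (hτ₀ : 0 < τ) (hτ₁ : τ < 1) :
    -- coverage of `(m, M)` and level of the test, uniformly on compact sets of parameters
    (∀ K : Set (I × I), IsCompact K →
      (∀ θ ∈ K, θ ∈ VoterModel.Params h ∧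
        deriv (VoterModel.phi h) (VoterModel.pPost θ) ≠ 0) →
      ∀ᶠ n : ℕ in atTop, ∀ θ ∈ K,
        1 - α ≤ (VoterModel.electionLaw θ n).real
          {ω | VoterModel.eta θ.1 (VoterModel.pPost θ) n ∈
            Set.Ioo (VoterModel.lowerEnd h z n (VoterModel.observedProp a b n ω))
              (VoterModel.upperEnd h z n (VoterModel.observedProp a b n ω))} ∧
        (τ ≤ VoterModel.eta θ.1 (VoterModel.pPost θ) n →
          (VoterModel.electionLaw θ n).real
            {ω | VoterModel.upperEnd h z n (VoterModel.observedProp a b n ω) < τ} ≤ α)) ∧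
    -- consistency of the test: on the limiting alternative the null hypothesis eventually fails,
    -- and it is rejected with probability tending to one
    (∀ θ ∈ VoterModel.Params h,
      (2 * (θ.1 : ℝ) - 1) * (2 * VoterModel.pPost θ - 1) < 0 →
        Tendsto (fun n : ℕ => VoterModel.eta θ.1 (VoterModel.pPost θ) n) atTop (𝓝 0) ∧
        Tendsto (fun n : ℕ => (VoterModel.electionLaw θ n).real
          {ω | VoterModel.upperEnd h z n (VoterModel.observedProp a b n ω) < τ}) atTop (𝓝 1)) := by
  have hz0 := VoterModel.quantile_pos hβ₁ hz
  -- The limiting coverage `1 - β` strictly exceeds `(1 - β)² = 1 - α`, so the finite-sample bound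
  -- can hold without an error term for large `n`.
  have hc : 1 - α < (gaussianReal 0 1).real (Set.Ioo (-z) z) := by
    rw [VoterModel.gaussianReal_Ioo_neg hz hz0, ← hβ]
    nlinarith
  refine ⟨fun K hK hKp ↦ ?_, fun θ hθ hopp ↦ ?_⟩
  · filter_upwards [hh.eventually_coverage hab₁ hab₂ hz0 hc hK hKp] with n hn θ hθ
    exact ⟨hn θ hθ, fun hτ ↦ VoterModel.electionLaw_upperEnd_lt_le (hn θ hθ) hτ⟩
  · obtain ⟨hdom, hphi, hlt, hlt1⟩ := hh.params_spec hθ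
    -- Since `p' < p₀`, opposite signs can only mean `p' < 1/2 < p₀`.
    have h₀ : 0 < 2 * (θ.1 : ℝ) - 1 := by nlinarith
    have h' : 2 * VoterModel.pPost θ - 1 < 0 := by nlinarith
    refine ⟨VoterModel.tendsto_eta_of_opposite hdom.1.le hlt1.le h₀ h', ?_⟩
    -- The level `τ / 2` makes the rejection inequality `M < τ` strict.
    obtain ⟨δ, hδ, hle⟩ := hh.exists_upperEnd_le hz0 hdom (by rwa [hphi]) h' (half_pos hτ₀)
    refine tendsto_of_tendsto_of_tendsto_of_le_of_le'
      (VoterModel.tendsto_electionLaw_abs_sub_lt hab₁ hab₂ θ hδ) tendsto_const_nhds ?_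
      (.of_forall fun n ↦ measureReal_le_one)
    filter_upwards [hle] with n hn
    refine measureReal_mono fun ω hω ↦ ?_
    exact (hn _ hω).trans_lt (by linarith)
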